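/- For $N\in\mathbb N$ let $\Sigma_N=\{-1,1\}^N$ and let $\{\mathrm{GREM}_N(\sigma)\}_{\sigma\in\Sigma_N}$ be the random energy model, i.e. the centred Gaussian process with covariance $\mathbb E[\mathrm{GREM}_N(\sigma)\mathrm{GREM}_N(\tau)]=\varrho(q_L(\sigma,\tau))$, where $q_L(\sigma,\tau)$ is $1/N$ times the length of the longest common initial segment of $\sigma$ and $\tau$, and $\varrho(x)=\mathbf 1_{\{x\ge 1\}}$ (so the $\mathrm{GREM}_N(\sigma)$ are i.i.d. standard Gaussian). For $h\ge 0$ put $$X_N(h,\sigma)=\mathrm{GREM}_N(\sigma)+\frac{h}{\sqrt N}\sum_{i=1}^N\sigma_i .$$ Let $I(t)=\tfrac12[(1-t)\log(1-t)+(1+t)\log(1+t)]$ and $\rho(t)=\sqrt{2(\log 2-I(t))}$ for $t\in[-1,1]$, let $M(h)=\max_{t\in[-1,1]}(\rho(t)+ht)$, and let $t_*=t_*(h)$ be the (unique) point where this maximum is attained. Define $$A_N(h)=\bigl(\rho(t_*)\sqrt N\bigr)^{-1},\qquad B_N(h)=M(h)\sqrt N+\frac{A_N(h)}{2}\log\left(\frac{A_N(h)^2}{2\pi(1-t_*^2)\,(I''(t_*)+h^2)}\right),\qquad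 u_{N,h}(x)=A_N(h)x+B_N(h).$$ Then, as $N\to\infty$, the point processes $$\sum_{\sigma\in\Sigma_N}\delta_{u_{N,h}^{-1}(X_N(h,\sigma))}$$ converge in distribution, as random elements of the space of locally finite Borel measures on $\mathbb R$ with the vague topology (the topology generated by integration against continuous compactly supported functions), to the Poisson point process on $\mathbb R$ with intensity $e^{-x}\,dx$. -/

import Mathlib

open MeasureTheory ProbabilityTheory Filter Topology Set
open scoped ENNReal NNReal CompactlySupported

noncomputable section

/-! ### Locally finite measures on the line, the vague topology, point processes -/

/-- Locally finite (equivalently, Radon) Borel measures on `ℝ`. -/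
structure LocFinMeasure where
  toMeasure : Measure ℝ
  locallyFinite : IsLocallyFiniteMeasure toMeasure

/-- The vague topology: the coarsest one for which `μ ↦ ∫ φ dμ` is continuous for every continuous
`φ : ℝ → ℝ` with compact support. -/
instance LocFinMeasure.instTopologicalSpace : TopologicalSpace LocFinMeasure :=
  TopologicalSpace.induced (fun μ (φ : C_c(ℝ, ℝ)) => ∫ x, φ x ∂μ.toMeasure) inferInstance

/-- The Borel `σ`-algebra of the vague topology. -/
instance LocFinMeasure.instMeasurableSpace : MeasurableSpace LocFinMeasure :=
  borel LocFinMeasure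

instance LocFinMeasure.instBorelSpace : BorelSpace LocFinMeasure := ⟨rfl⟩

/-- `ξ` is a Poisson point process on `ℝ` with intensity measure `ν`. -/
structure IsPoissonPointProcess {Ω : Type*} [MeasurableSpace Ω] (P : Measure Ω) (ν : Measure ℝ)
    (ξ : Ω → LocFinMeasure) : Prop where
  measurable : Measurable ξ
  map_count : ∀ B : Set ℝ, MeasurableSet B → ν B ≠ ∞ →
    P.map (fun ω => (ξ ω).toMeasure B) =
      (poissonMeasure (ν B).toNNReal).map (fun k : ℕ => (k : ℝ≥0∞))
  indep_counts : ∀ (m : ℕ) (B : Fin m → Set ℝ), (∀ i, MeasurableSet (B i)) →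
    Pairwise (fun i j => Disjoint (B i) (B j)) →
    iIndepFun (fun i ω => (ξ ω).toMeasure (B i)) P

/-- The measure `exp (-x) dx` on `ℝ`. -/
def expIntensity : Measure ℝ :=
  volume.withDensity (fun x => ENNReal.ofReal (Real.exp (-x)))

/-! ### The random energy model with external field -/

/-- The discrete hypercube `{-1, 1}^N`. -/
abbrev Hypercube (N : ℕ) : Type := Fin N → ℤˣ

/-- Normalized lexicographic overlap: `1 / N` times the length of the longest common initial
segment of `σ` and `τ`. -/
def lexOverlap {N : ℕ} (σ τ : Hypercube N) : ℝ :=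
  (Nat.findGreatest (fun k => ∀ i : Fin N, (i : ℕ) < k → σ i = τ i) N : ℝ) / N

/-- The order parameter with a single jump (from `0` to `1`, at the point `1`). -/
def remOrderParameter (x : ℝ) : ℝ := if 1 ≤ x then 1 else 0

/-- `Y` is the random energy model on `{-1, 1}^N`: a centred Gaussian process whose covariance is
the one-jump order parameter of the lexicographic overlap. -/
structure IsREM {Ω : Type*} [MeasurableSpace Ω] (P : Measure Ω) (N : ℕ)
    (Y : Hypercube N → Ω → ℝ) : Prop where
  gaussian : IsGaussianProcess Y P
  centred : ∀ σ, ∫ ω, Y σ ω ∂P = 0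
  covariance : ∀ σ τ, ∫ ω, Y σ ω * Y τ ω ∂P = remOrderParameter (lexOverlap σ τ)

/-- The process `X_N(h, σ)`: the model `Y` plus an external field of strength `h`. -/
def withField {Ω : Type*} {N : ℕ} (Y : Hypercube N → Ω → ℝ) (h : ℝ) (σ : Hypercube N) (ω : Ω) : ℝ :=
  Y σ ω + h / Real.sqrt N * ∑ i, ((σ i : ℤ) : ℝ)

/-! ### The scaling -/

/-- Cramér's entropy `I` (used on `[-1, 1]`; `0 * log 0 = 0`). -/
def cramerEntropy (t : ℝ) : ℝ :=
  ((1 - t) * Real.log (1 - t) + (1 + t) * Real.log (1 + t)) / 2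

/-- `ρ(t) = √(2 (log 2 - I(t)))`. -/
def rhoFun (t : ℝ) : ℝ := Real.sqrt (2 * (Real.log 2 - cramerEntropy t))

/-- `M(h)`, the maximum of `ρ(t) + h t` over `[-1, 1]`. -/
def maxEnergy (h : ℝ) : ℝ := sSup ((fun t => rhoFun t + h * t) '' Icc (-1) 1)

theorem continuous_cramerEntropy : Continuous cramerEntropy := by
  have h1 : Continuous fun t : ℝ => (1 - t) * Real.log (1 - t) :=
    Real.continuous_mul_log.comp (continuous_const.sub continuous_id)
  have h2 : Continuous fun t : ℝ => (1 + t) * Real.log (1 + t) :=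
    Real.continuous_mul_log.comp (continuous_const.add continuous_id)
  exact (h1.add h2).div_const 2

theorem exists_maximizer (h : ℝ) :
    ∃ t ∈ Icc (-1 : ℝ) 1, IsMaxOn (fun t => rhoFun t + h * t) (Icc (-1) 1) t := by
  refine isCompact_Icc.exists_isMaxOn ⟨0, by norm_num, by norm_num⟩ (Continuous.continuousOn ?_)
  have := continuous_cramerEntropy
  unfold rhoFun
  fun_prop

/-- `t_*(h)`, the point of `[-1, 1]` where `ρ(t) + h t` is maximal. (It is unique, the function
being strictly concave.) -/
def tStar (h : ℝ) : ℝ := (exists_maximizer h).choose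

theorem tStar_mem (h : ℝ) : tStar h ∈ Icc (-1 : ℝ) 1 := (exists_maximizer h).choose_spec.1

theorem tStar_isMaxOn (h : ℝ) : IsMaxOn (fun t => rhoFun t + h * t) (Icc (-1) 1) (tStar h) :=
  (exists_maximizer h).choose_spec.2

/-- `A_N(h)`. -/
def scaleA (N : ℕ) (h : ℝ) : ℝ := (rhoFun (tStar h) * Real.sqrt N)⁻¹

/-- `B_N(h)`. -/
def scaleB (N : ℕ) (h : ℝ) : ℝ :=
  maxEnergy h * Real.sqrt N + scaleA N h / 2 *
    Real.log (scaleA N h ^ 2 /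
      (2 * Real.pi * (1 - tStar h ^ 2) * (iteratedDeriv 2 cramerEntropy (tStar h) + h ^ 2)))

/-- The scaling function `u_{N,h}`. -/
def remScaling (N : ℕ) (h x : ℝ) : ℝ := scaleA N h * x + scaleB N h

/-- The inverse of `u_{N,h}`. -/
def remScalingInv (N : ℕ) (h y : ℝ) : ℝ := (y - scaleB N h) / scaleA N h

theorem remScalingInv_remScaling {N : ℕ} {h : ℝ} (hA : scaleA N h ≠ 0) (x : ℝ) :
    remScalingInv N h (remScaling N h x) = x := by
  simp [remScalingInv, remScaling, hA]

theorem remScaling_remScalingInv {N : ℕ} {h : ℝ} (hA : scaleA N h ≠ 0) (y : ℝ) :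
    remScaling N h (remScalingInv N h y) = y := by
  unfold remScalingInv remScaling
  field_simp
  ring

/-- The point process `∑_σ δ_{u_{N,h}⁻¹(X_N(h, σ))}` of rescaled energies. -/
def energyProcess {Ω : Type*} {N : ℕ} (Y : Hypercube N → Ω → ℝ) (h : ℝ) (ω : Ω) : LocFinMeasure where
  toMeasure := ∑ σ : Hypercube N, Measure.dirac (remScalingInv N h (withField Y h σ ω))
  locallyFinite := inferInstance

end

/-! ### The vague topology -/

/-! The energies are independent, so a Poisson limit needs only two facts: the expected number of
rescaled points in `[x, ∞)` tends to `exp (-x)`, and no single point has a non-negligible chance of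
lying in a given bounded interval.

The expected number is a sum over `σ` of Gaussian tails at the level `y = ρ√N + d - hW`, where `ρ =
rhoFun (tStar h)`, `W = (∑ σ_i - N t_*) / √N` and `d → 0` is `levelShift`. In `exp (-y²/2)` the
factor `exp (-Nρ²/2 + hρ√N W)` is, by stationarity of `ρ(t) + ht` at `t_*`, exactly the probability
of `σ` under independent coins of mean `t_*` (`prod_coinWeight_tStar`). The sum is thus an
expectation over coins of essentially `exp (-(hW)²/2)`. By the central limit theorem it tends to `(1
+ h²(1 - t_*²))^(-1/2)`, and since `I''(t) = 1/(1 - t²)`, the logarithm in `B_N` cancels this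
constant together with the prefactor of the Gaussian tail (`tendsto_sum_gaussianTail`).

Smallness of each point comes from `h < M(h)` (`lt_maxEnergy`): every level is at least a positive
multiple of `√N`. Characteristic functions then give joint Poisson limits for counts in disjoint
intervals (`tendstoInDistribution_sum_indicator`). Passing to random measures
(`tendstoInDistribution_of_binMasses`) uses tightness and discretization onto a grid. Vague
compactness is exploited through ultrafilters and the Riesz representation theorem, so no metric on
the space of measures is needed. -/

instance (μ : LocFinMeasure) : IsLocallyFiniteMeasure μ.toMeasure := μ.locallyFinite

namespace LocFinMeasure

theorem tendsto_iff_integral {ι : Type*} {l : Filter ι} {μ : ι → LocFinMeasure}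
    {ν : LocFinMeasure} :
    Tendsto μ l (𝓝 ν) ↔ ∀ φ : C_c(ℝ, ℝ), Tendsto (fun i => ∫ x, φ x ∂(μ i).toMeasure) l
      (𝓝 (∫ x, φ x ∂ν.toMeasure)) := by
  rw [(Topology.IsInducing.mk rfl : Topology.IsInducing
    (fun (μ : LocFinMeasure) (φ : C_c(ℝ, ℝ)) => ∫ x, φ x ∂μ.toMeasure)).tendsto_nhds_iff,
    tendsto_pi_nhds]
  rfl

theorem continuous_iff_integral {X : Type*} [TopologicalSpace X] {f : X → LocFinMeasure} :
    Continuous f ↔ ∀ φ : C_c(ℝ, ℝ), Continuous fun x => ∫ y, φ y ∂(f x).toMeasure := by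
  simp only [continuous_iff_continuousAt, ContinuousAt, tendsto_iff_integral]
  exact ⟨fun H φ x => H x φ, fun H x φ => H φ x⟩

theorem integrable_compactlySupported (μ : LocFinMeasure) (φ : C_c(ℝ, ℝ)) :
    Integrable φ μ.toMeasure :=
  φ.continuous.integrable_of_hasCompactSupport φ.hasCompactSupport

theorem measure_Ico_lt_top (μ : LocFinMeasure) (a b : ℝ) : μ.toMeasure (Ico a b) < ∞ :=
  (measure_mono Ico_subset_Icc_self).trans_lt isCompact_Icc.measure_lt_top

/-- A functional on `C_c(ℝ, ℝ)` that is a limit of integrals is an integral. -/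
theorem exists_of_tendsto_integral {ι : Type*} {l : Filter ι} [l.NeBot] {μ : ι → LocFinMeasure}
    {Λ : C_c(ℝ, ℝ) → ℝ}
    (hΛ : ∀ φ : C_c(ℝ, ℝ), Tendsto (fun i => ∫ x, φ x ∂(μ i).toMeasure) l (𝓝 (Λ φ))) :
    ∃ ν : LocFinMeasure, Tendsto μ l (𝓝 ν) := by
  let Λ' : C_c(ℝ, ℝ) →ₗ[ℝ] ℝ :=
    { toFun := Λ
      map_add' := fun φ ψ => by
        refine tendsto_nhds_unique (hΛ (φ + ψ)) (((hΛ φ).add (hΛ ψ)).congr fun i => ?_)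
        rw [← integral_add ((μ i).integrable_compactlySupported φ)
          ((μ i).integrable_compactlySupported ψ)]
        rfl
      map_smul' := fun c φ => by
        refine tendsto_nhds_unique (hΛ (c • φ)) (((hΛ φ).const_mul c).congr fun i => ?_)
        rw [← integral_const_mul]
        rfl }
  have hpos : ∀ φ : C_c(ℝ, ℝ), 0 ≤ φ → 0 ≤ Λ' φ := fun φ hφ =>
    ge_of_tendsto' (hΛ φ) fun i => integral_nonneg fun x => hφ x
  refine ⟨⟨RealRMK.rieszMeasure (PositiveLinearMap.mk₀ Λ' hpos), inferInstance⟩,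
    tendsto_iff_integral.2 fun φ => ?_⟩
  rw [RealRMK.integral_rieszMeasure]
  exact hΛ φ

theorem exists_forall_eq_zero_of_le_abs (φ : C_c(ℝ, ℝ)) :
    ∃ k : ℕ, ∀ x : ℝ, (k : ℝ) ≤ |x| → φ x = 0 := by
  obtain ⟨R, hR⟩ := φ.hasCompactSupport.isCompact.isBounded.subset_closedBall (0 : ℝ)
  obtain ⟨k, hk⟩ := exists_nat_gt R
  refine ⟨k, fun x hx => ?_⟩
  by_contra hne
  have := hR (subset_tsupport _ hne)
  rw [mem_closedBall_zero_iff, Real.norm_eq_abs] at this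
  linarith

theorem abs_integral_le_of_abs_le {μ : LocFinMeasure} {f : ℝ → ℝ} {c a b : ℝ}
    (hf : ∀ x, |f x| ≤ (Ico a b).indicator (fun _ => c) x) :
    |∫ x, f x ∂μ.toMeasure| ≤ μ.toMeasure.real (Ico a b) * c := by
  calc |∫ x, f x ∂μ.toMeasure| ≤ ∫ x, (Ico a b).indicator (fun _ => c) x ∂μ.toMeasure := by
        rw [← Real.norm_eq_abs]
        exact norm_integral_le_of_norm_le ((integrable_indicator_iff measurableSet_Ico).2
          (integrableOn_const (μ.measure_Ico_lt_top a b).ne)) (ae_of_all _ hf)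
    _ = _ := by rw [integral_indicator_const _ measurableSet_Ico, smul_eq_mul]

/-- Along an ultrafilter, measures with uniformly bounded masses of bounded intervals converge. -/
theorem exists_tendsto_ultrafilter {ι : Type*} (U : Ultrafilter ι) {μ : ι → LocFinMeasure}
    {C : ℕ → ℝ} (hC : ∀ i (k : ℕ), (μ i).toMeasure.real (Ico (-k : ℝ) k) ≤ C k) :
    ∃ ν : LocFinMeasure, Tendsto μ U (𝓝 ν) := by
  have key : ∀ φ : C_c(ℝ, ℝ), ∃ L, Tendsto (fun i => ∫ x, φ x ∂(μ i).toMeasure) U (𝓝 L) := by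
    intro φ
    obtain ⟨k, hk⟩ := exists_forall_eq_zero_of_le_abs φ
    obtain ⟨D, hD⟩ := φ.hasCompactSupport.exists_bound_of_continuous φ.continuous
    have hD0 : 0 ≤ D := (norm_nonneg _).trans (hD 0)
    have hb : ∀ i, (∫ x, φ x ∂(μ i).toMeasure) ∈ Icc (-(C k * D)) (C k * D) := by
      intro i
      refine abs_le.1 ?_
      refine (abs_integral_le_of_abs_le (a := -k) (b := k) (c := D) fun x => ?_).trans
        (mul_le_mul_of_nonneg_right (hC i k) hD0)
      by_cases hx : x ∈ Ico (-k : ℝ) k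
      · rw [indicator_of_mem hx]
        exact hD x
      · rw [indicator_of_notMem hx, hk x, abs_zero]
        by_contra! hlt
        rw [abs_lt] at hlt
        exact hx ⟨hlt.1.le, hlt.2⟩
    obtain ⟨L, -, hL⟩ := isCompact_Icc.ultrafilter_le_nhds
      (U.map fun i => ∫ x, φ x ∂(μ i).toMeasure)
      (by rw [Ultrafilter.coe_map, le_principal_iff]
          exact Eventually.of_forall (f := (U : Filter ι)) hb)
    exact ⟨L, hL⟩
  choose Λ hΛ using key
  exact exists_of_tendsto_integral hΛ

/-! ### Discretization -/

/-- The `j`-th of the intervals of length `1 / n` into which `[-n, n)` is divided. -/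
noncomputable def bin (n : ℕ) (j : Fin (2 * n * n)) : Set ℝ := {x | ⌊(n : ℝ) * x⌋ = (j : ℤ) - n * n}

/-- The left end point of `bin n j`. -/
noncomputable def node (n : ℕ) (j : Fin (2 * n * n)) : ℝ := ((j : ℝ) - n * n) / n

theorem bin_eq_Ico {n : ℕ} (j : Fin (2 * n * n)) : bin n j = Ico (node n j) (node n j + 1 / n) := by
  have hn : (0 : ℝ) < n := by
    rcases Nat.eq_zero_or_pos n with rfl | h
    · exact absurd j.2 (by simp)
    · exact_mod_cast h
  ext x
  have e : node n j + 1 / n = (((j : ℝ) - n * n) + 1) / n := by unfold node; ring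
  rw [e, bin, mem_ofPred_eq, Int.floor_eq_iff, mem_Ico, node, div_le_iff₀ hn, lt_div_iff₀ hn]
  push_cast
  rw [mul_comm x]

theorem measurableSet_bin {n : ℕ} (j : Fin (2 * n * n)) : MeasurableSet (bin n j) := by
  rw [bin_eq_Ico]
  exact measurableSet_Ico

theorem pairwise_disjoint_bin (n : ℕ) : Pairwise fun i j => Disjoint (bin n i) (bin n j) := by
  intro i j hij
  rw [Set.disjoint_left]
  intro x (hi : _ = _) (hj : _ = _)
  apply hij
  ext
  rw [hi] at hj
  omega

theorem floor_div_eq_node {n : ℕ} {j : Fin (2 * n * n)} {x : ℝ} (hx : x ∈ bin n j) :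
    (⌊(n : ℝ) * x⌋ : ℝ) / n = node n j := by
  rw [show ⌊(n : ℝ) * x⌋ = (j : ℤ) - n * n from hx, node]
  push_cast
  rfl

theorem exists_mem_bin {n : ℕ} {x : ℝ} (hx : x ∈ Ico (-n : ℝ) n) : ∃ j, x ∈ bin n j := by
  have hn : (0 : ℝ) < n := by
    have := hx.1.trans_lt hx.2
    linarith
  have h1 : -(n * n : ℤ) ≤ ⌊(n : ℝ) * x⌋ := by
    rw [Int.le_floor]
    push_cast
    nlinarith [hx.1]
  have h2 : ⌊(n : ℝ) * x⌋ < (n * n : ℤ) := by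
    rw [Int.floor_lt]
    push_cast
    nlinarith [hx.2]
  have e : 2 * n * n = n * n + n * n := by ring
  refine ⟨⟨(⌊(n : ℝ) * x⌋ + n * n).toNat, ?_⟩, ?_⟩
  · rw [e]
    zify
    rw [Int.toNat_of_nonneg (by linarith)]
    linarith
  · simp only [bin, mem_ofPred_eq]
    rw [Int.toNat_of_nonneg (by linarith)]
    ring

/-- The measure with masses `c j` at the nodes. -/
noncomputable def ofBinMasses (n : ℕ) (c : Fin (2 * n * n) → ℝ) : LocFinMeasure where
  -- Truncating negative entries makes this a continuous map on all real vectors; it changes nothing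
  -- for actual masses.
  toMeasure := ∑ j, (c j).toNNReal • Measure.dirac (node n j)
  locallyFinite := inferInstance

theorem integral_ofBinMasses (n : ℕ) (c : Fin (2 * n * n) → ℝ) (φ : C_c(ℝ, ℝ)) :
    ∫ x, φ x ∂(ofBinMasses n c).toMeasure = ∑ j, max (c j) 0 * φ (node n j) := by
  have hint : ∀ j, Integrable φ ((c j).toNNReal • Measure.dirac (node n j)) := fun j =>
    integrable_compactlySupported ⟨_, inferInstance⟩ φ
  rw [ofBinMasses, integral_finsetSum_measure fun j _ => hint j]
  refine Finset.sum_congr rfl fun j _ => ?_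
  rw [integral_smul_nnreal_measure, integral_dirac]
  rfl

theorem continuous_ofBinMasses (n : ℕ) : Continuous (ofBinMasses n) := by
  rw [continuous_iff_integral]
  intro φ
  simp only [integral_ofBinMasses]
  fun_prop

/-- The masses that a measure gives to the intervals `bin n j`. -/
noncomputable def binMasses (n : ℕ) (μ : LocFinMeasure) (j : Fin (2 * n * n)) : ℝ :=
  μ.toMeasure.real (bin n j)

theorem measure_bin_ne_top (μ : LocFinMeasure) {n : ℕ} (j : Fin (2 * n * n)) :
    μ.toMeasure (bin n j) ≠ ∞ := by
  rw [bin_eq_Ico]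
  exact (μ.measure_Ico_lt_top _ _).ne

/-- The discretized integral is the integral of `φ (⌊n x⌋ / n)`, whose argument is within `1 / n` of
`x`. Rounding moves points by at most `1`, hence the window `k + 1` rather than `k`. -/
theorem abs_integral_sub_integral_ofBinMasses_le (μ : LocFinMeasure) (φ : C_c(ℝ, ℝ)) {n k : ℕ}
    (hk : ∀ x : ℝ, (k : ℝ) ≤ |x| → φ x = 0) (hkn : k + 1 ≤ n) {c : ℝ}
    (hc : ∀ x y : ℝ, |x - y| ≤ 1 / n → |φ x - φ y| ≤ c) :
    |∫ x, φ x ∂μ.toMeasure - ∫ x, φ x ∂(ofBinMasses n (binMasses n μ)).toMeasure| ≤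
      μ.toMeasure.real (Ico (-(k + 1 : ℕ) : ℝ) (k + 1 : ℕ)) * c := by
  have hn : (0 : ℝ) < n := by exact_mod_cast (Nat.succ_pos k).trans_le hkn
  have hn1 : (1 : ℝ) / n ≤ 1 := by
    rw [div_le_one hn]
    exact_mod_cast (Nat.le_add_left 1 k).trans hkn
  have hkn' : (k : ℝ) + 1 ≤ n := by exact_mod_cast hkn
  have hint : ∀ j, Integrable ((bin n j).indicator fun _ => φ (node n j)) μ.toMeasure := fun j =>
    (integrable_indicator_iff (measurableSet_bin j)).2 (integrableOn_const (μ.measure_bin_ne_top j))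
  have e : ∫ x, φ x ∂(ofBinMasses n (binMasses n μ)).toMeasure =
      ∫ x, ∑ j, (bin n j).indicator (fun _ => φ (node n j)) x ∂μ.toMeasure := by
    rw [integral_ofBinMasses, integral_finsetSum _ fun j _ => hint j]
    refine Finset.sum_congr rfl fun j _ => ?_
    rw [integral_indicator_const _ (measurableSet_bin j), binMasses, smul_eq_mul,
      max_eq_left measureReal_nonneg]
  rw [e, ← integral_sub (μ.integrable_compactlySupported φ)
    (integrable_finsetSum _ fun j _ => hint j)]
  have hsum : ∀ {x j}, x ∈ bin n j →
      ∑ i, (bin n i).indicator (fun _ => φ (node n i)) x = φ (⌊(n : ℝ) * x⌋ / n) := by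
    intro x j hx
    rw [Finset.sum_eq_single j, indicator_of_mem hx, floor_div_eq_node hx]
    · exact fun i _ hij => indicator_of_notMem
        (fun hi => Set.disjoint_left.1 (pairwise_disjoint_bin n hij) hi hx) _
    · simp
  have hfl : ∀ x : ℝ, (⌊(n : ℝ) * x⌋ : ℝ) / n ≤ x ∧ x < (⌊(n : ℝ) * x⌋ : ℝ) / n + 1 / n := by
    intro x
    rw [← add_div, div_le_iff₀ hn, lt_div_iff₀ hn, mul_comm x]
    exact ⟨Int.floor_le _, Int.lt_floor_add_one _⟩
  refine abs_integral_le_of_abs_le fun x => ?_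
  by_cases hx : x ∈ Ico (-(k + 1 : ℕ) : ℝ) (k + 1 : ℕ)
  · obtain ⟨j, hj⟩ := exists_mem_bin (n := n) (x := x)
      ⟨by have := hx.1; push_cast at this; linarith, by have := hx.2; push_cast at this; linarith⟩
    rw [indicator_of_mem hx, hsum hj]
    refine hc _ _ ?_
    have := hfl x
    rw [abs_le]
    constructor <;> linarith
  · rw [indicator_of_notMem hx]
    have hx' : x < -((k : ℝ) + 1) ∨ (k : ℝ) + 1 ≤ x := by
      by_contra! hlt
      exact hx ⟨by push_cast; exact hlt.1, by push_cast; exact hlt.2⟩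
    have h1 : φ x = 0 := hk x (by
      rw [le_abs]
      rcases hx' with h | h
      · right; linarith
      · left; linarith)
    have h2 : ∑ i, (bin n i).indicator (fun _ => φ (node n i)) x = 0 := by
      by_cases hj : ∃ j, x ∈ bin n j
      · obtain ⟨j, hj⟩ := hj
        rw [hsum hj]
        refine hk _ ?_
        have := hfl x
        rw [le_abs]
        rcases hx' with h | h
        · right; linarith
        · left; linarith
      · push Not at hj
        exact Finset.sum_eq_zero fun j _ => indicator_of_notMem (hj j) _
    rw [h1, h2, sub_zero, abs_zero]

/-- Discretization is asymptotically the identity on relatively compact sets of measures. -/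
theorem tendsto_comp_sub_comp_ofBinMasses {F : LocFinMeasure → ℝ} (hF : Continuous F)
    {μ : ℕ → LocFinMeasure} {C : ℕ → ℝ}
    (hC : ∀ i (k : ℕ), (μ i).toMeasure.real (Ico (-k : ℝ) k) ≤ C k) :
    Tendsto (fun n => F (μ n) - F (ofBinMasses n (binMasses n (μ n)))) atTop (𝓝 0) := by
  -- Along an ultrafilter the measures have a vague limit, their discretizations share it, and `F`
  -- is continuous there.
  rw [tendsto_iff_ultrafilter]
  intro U hU
  obtain ⟨ν, hν⟩ := exists_tendsto_ultrafilter U hC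
  have hν' : Tendsto (fun n => ofBinMasses n (binMasses n (μ n))) U (𝓝 ν) := by
    rw [tendsto_iff_integral] at hν ⊢
    intro φ
    have hdiff : Tendsto (fun n => ∫ x, φ x ∂(μ n).toMeasure -
        ∫ x, φ x ∂(ofBinMasses n (binMasses n (μ n))).toMeasure) U (𝓝 0) := by
      refine Tendsto.mono_left ?_ hU
      obtain ⟨k, hk⟩ := exists_forall_eq_zero_of_le_abs φ
      have hC0 : 0 ≤ C (k + 1) := measureReal_nonneg.trans (hC 0 (k + 1))
      rw [Metric.tendsto_atTop]
      intro ε hε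
      obtain ⟨δ, hδ, hφ⟩ := Metric.uniformContinuous_iff.1
        (φ.hasCompactSupport.uniformContinuous_of_continuous φ.continuous)
        (ε / (C (k + 1) + 1)) (by positivity)
      obtain ⟨m, hm⟩ := exists_nat_gt (1 / δ)
      refine ⟨max (k + 1) m, fun n hn => ?_⟩
      have hn0 : (0 : ℝ) < n := by
        exact_mod_cast (Nat.succ_pos k).trans_le ((le_max_left _ _).trans hn)
      have hnδ : 1 / (n : ℝ) < δ := by
        rw [div_lt_comm₀ hn0 hδ]
        exact hm.trans_le (by exact_mod_cast (le_max_right _ _).trans hn)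
      rw [Real.dist_0_eq_abs]
      refine (abs_integral_sub_integral_ofBinMasses_le (μ n) φ hk ((le_max_left _ _).trans hn)
        (c := ε / (C (k + 1) + 1)) fun x y hxy => ?_).trans_lt ?_
      · exact (hφ (by rw [Real.dist_eq]; linarith : dist x y < δ)).le
      · calc _ ≤ C (k + 1) * (ε / (C (k + 1) + 1)) :=
              mul_le_mul_of_nonneg_right (hC n (k + 1)) (by positivity)
          _ < ε := by
              rw [mul_div_assoc', div_lt_iff₀ (by positivity)]
              nlinarith
    simpa using (hν φ).sub hdiff
  simpa using (hF.continuousAt.tendsto.comp hν).sub (hF.continuousAt.tendsto.comp hν')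

/-- Uniformity over the class of measures follows from the sequential statement, applied to a
sequence of counterexamples chosen wherever one exists. -/
theorem eventually_forall_abs_comp_sub_comp_ofBinMasses_lt {F : LocFinMeasure → ℝ}
    (hF : Continuous F) (C : ℕ → ℝ) {ε : ℝ} (hε : 0 < ε) :
    ∀ᶠ n in atTop, ∀ μ : LocFinMeasure, (∀ k : ℕ, μ.toMeasure.real (Ico (-k : ℝ) k) ≤ C k) →
      |F μ - F (ofBinMasses n (binMasses n μ))| < ε := by
  by_cases hne : ∃ μ₀ : LocFinMeasure, ∀ k : ℕ, μ₀.toMeasure.real (Ico (-k : ℝ) k) ≤ C k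
  swap
  · exact Eventually.of_forall fun n μ hμ => absurd ⟨μ, hμ⟩ hne
  obtain ⟨μ₀, hμ₀⟩ := hne
  have key : ∀ n : ℕ, ∃ μ : LocFinMeasure, (∀ k : ℕ, μ.toMeasure.real (Ico (-k : ℝ) k) ≤ C k) ∧
      (|F μ - F (ofBinMasses n (binMasses n μ))| < ε → ∀ μ : LocFinMeasure,
        (∀ k : ℕ, μ.toMeasure.real (Ico (-k : ℝ) k) ≤ C k) →
          |F μ - F (ofBinMasses n (binMasses n μ))| < ε) := by
    intro n
    by_cases h : ∀ μ : LocFinMeasure, (∀ k : ℕ, μ.toMeasure.real (Ico (-k : ℝ) k) ≤ C k) →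
          |F μ - F (ofBinMasses n (binMasses n μ))| < ε
    · exact ⟨μ₀, hμ₀, fun _ => h⟩
    · push Not at h
      obtain ⟨μ, hμ, hge⟩ := h
      exact ⟨μ, hμ, fun hlt => absurd hlt hge.not_gt⟩
  choose μ hμ hlt using key
  have := tendsto_comp_sub_comp_ofBinMasses hF hμ
  filter_upwards [this.eventually (Metric.ball_mem_nhds 0 hε)] with n hn
  exact hlt n (by simpa using hn)

end LocFinMeasure

/-- Convergence in distribution, in terms of expectations of bounded continuous functions. -/
theorem tendstoInDistribution_iff_integral {E ι : Type*} [TopologicalSpace E] [MeasurableSpace E]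
    [OpensMeasurableSpace E] {l : Filter ι} {Ω : ι → Type*} [∀ i, MeasurableSpace (Ω i)]
    {P : (i : ι) → Measure (Ω i)} [∀ i, IsProbabilityMeasure (P i)]
    {Ω' : Type*} [MeasurableSpace Ω'] {P' : Measure Ω'} [IsProbabilityMeasure P']
    {X : (i : ι) → Ω i → E} {Z : Ω' → E}
    (hX : ∀ i, AEMeasurable (X i) (P i)) (hZ : AEMeasurable Z P') :
    TendstoInDistribution X l Z P P' ↔ ∀ F : BoundedContinuousFunction E ℝ,
      Tendsto (fun i => ∫ ω, F (X i ω) ∂(P i)) l (𝓝 (∫ ω, F (Z ω) ∂P')) := by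
  have h1 : ∀ (F : BoundedContinuousFunction E ℝ) i,
      ∫ x, F x ∂((P i).map (X i)) = ∫ ω, F (X i ω) ∂(P i) := fun F i =>
    integral_map (hX i) F.continuous.measurable.aestronglyMeasurable
  have h2 : ∀ F : BoundedContinuousFunction E ℝ,
      ∫ x, F x ∂(P'.map Z) = ∫ ω, F (Z ω) ∂P' := fun F =>
    integral_map hZ F.continuous.measurable.aestronglyMeasurable
  constructor
  · intro h F
    have := ProbabilityMeasure.tendsto_iff_forall_integral_tendsto.1 h.tendsto F
    rw [← h2 F]
    exact this.congr fun i => h1 F i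
  · intro h
    refine ⟨hX, hZ, ProbabilityMeasure.tendsto_iff_forall_integral_tendsto.2 fun F => ?_⟩
    have := (h F).congr fun i => (h1 F i).symm
    rw [← h2 F] at this
    exact this

namespace LocFinMeasure

/-! ### A criterion for convergence in distribution -/

theorem measureReal_iUnion_le_of_le_geometric {Ω : Type*} [MeasurableSpace Ω] {P : Measure Ω}
    {B : ℕ → Set Ω} {δ : ℝ} (hδ : 0 ≤ δ) [IsFiniteMeasure P]
    (hB : ∀ k, P.real (B k) ≤ δ / 2 / 2 ^ k) : P.real (⋃ k, B k) ≤ δ := by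
  refine ENNReal.toReal_le_of_le_ofReal hδ ((measure_iUnion_le B).trans ?_)
  calc ∑' k, P (B k) ≤ ∑' k, ENNReal.ofReal (δ / 2 / 2 ^ k) :=
        ENNReal.tsum_le_tsum fun k => by
          rw [← ofReal_measureReal]
          exact ENNReal.ofReal_le_ofReal (hB k)
    _ = ENNReal.ofReal δ := by
        rw [← ENNReal.ofReal_tsum_of_nonneg (fun k => by positivity) (summable_geometric_two' δ),
          tsum_geometric_two']

/-- Outside an event of probability at most `δ` all mass bounds hold and the error is at most `ε`;
on that event the trivial bound `2 * D` is used. -/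
theorem abs_integral_comp_sub_integral_comp_ofBinMasses_le {Ω : Type*} [MeasurableSpace Ω]
    {P : Measure Ω} [IsProbabilityMeasure P] {X : Ω → LocFinMeasure} (hX : AEMeasurable X P)
    {n : ℕ} (hXn : AEMeasurable (fun ω => binMasses n (X ω)) P)
    {F : LocFinMeasure → ℝ} (hF : Continuous F) {D : ℝ} (hD : ∀ μ, |F μ| ≤ D)
    {C : ℕ → ℝ} {δ ε : ℝ} (hδ : 0 ≤ δ) (hε : 0 ≤ ε)
    (hC : ∀ k : ℕ, P.real {ω | C k < (X ω).toMeasure.real (Ico (-k : ℝ) k)} ≤ δ / 2 / 2 ^ k)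
    (hn : ∀ μ : LocFinMeasure, (∀ k : ℕ, μ.toMeasure.real (Ico (-k : ℝ) k) ≤ C k) →
      |F μ - F (ofBinMasses n (binMasses n μ))| ≤ ε) :
    |∫ ω, F (X ω) ∂P - ∫ ω, F (ofBinMasses n (binMasses n (X ω))) ∂P| ≤ ε + δ * (2 * D) := by
  have hD0 : 0 ≤ D := (abs_nonneg _).trans (hD ⟨0, inferInstance⟩)
  have hint : ∀ {Z : Ω → LocFinMeasure}, AEMeasurable Z P → Integrable (fun ω => F (Z ω)) P :=
    fun hZ => .of_bound (hF.measurable.comp_aemeasurable hZ).aestronglyMeasurable D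
      (ae_of_all _ fun ω => hD _)
  have hint' : Integrable (fun ω => F (ofBinMasses n (binMasses n (X ω)))) P := by
    refine .of_bound (AEMeasurable.aestronglyMeasurable ?_) D (ae_of_all _ fun ω => hD _)
    exact (hF.comp (continuous_ofBinMasses n)).measurable.comp_aemeasurable hXn
  -- This event need not be measurable, so its measurable hull is used below.
  set B : Set Ω := ⋃ k : ℕ, {ω | C k < (X ω).toMeasure.real (Ico (-k : ℝ) k)} with hBdef
  have hB : P.real (toMeasurable P B) ≤ δ := by
    rw [measureReal_def, measure_toMeasurable]
    exact measureReal_iUnion_le_of_le_geometric hδ hC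
  rw [← integral_sub (hint hX) hint', ← Real.norm_eq_abs]
  calc _ ≤ ∫ ω, (ε + (toMeasurable P B).indicator (fun _ => 2 * D) ω) ∂P := by
        refine norm_integral_le_of_norm_le ((integrable_const _).add
          ((integrable_const _).indicator (measurableSet_toMeasurable _ _)))
          (ae_of_all _ fun ω => ?_)
        rw [Real.norm_eq_abs]
        by_cases hω : ω ∈ toMeasurable P B
        · rw [indicator_of_mem hω]
          have h1 := hD (X ω)
          have h2 := hD (ofBinMasses n (binMasses n (X ω)))
          have h3 := abs_sub (F (X ω)) (F (ofBinMasses n (binMasses n (X ω))))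
          linarith
        · rw [indicator_of_notMem hω, add_zero]
          refine hn _ fun k => ?_
          by_contra! hlt
          exact hω (subset_toMeasurable _ _ (mem_iUnion.2 ⟨k, hlt⟩))
    _ = ε + P.real (toMeasurable P B) * (2 * D) := by
        rw [integral_add (integrable_const _)
          ((integrable_const _).indicator (measurableSet_toMeasurable _ _)),
          integral_indicator_const _ (measurableSet_toMeasurable _ _)]
        simp
    _ ≤ _ := by gcongr

/-- Random measures converge in distribution if their masses of bounded intervals are tight and
the vectors of their masses of the intervals `bin n j` converge in distribution. -/
theorem tendstoInDistribution_of_binMasses {Ω : ℕ → Type*} [∀ N, MeasurableSpace (Ω N)]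
    {P : (N : ℕ) → Measure (Ω N)} [∀ N, IsProbabilityMeasure (P N)]
    {Ω' : Type*} [MeasurableSpace Ω'] {P' : Measure Ω'} [IsProbabilityMeasure P']
    {X : (N : ℕ) → Ω N → LocFinMeasure} {ξ : Ω' → LocFinMeasure}
    (hX : ∀ N, AEMeasurable (X N) (P N)) (hξ : AEMeasurable ξ P')
    (tX : ∀ (k : ℕ) (ε : ℝ), 0 < ε → ∃ C : ℝ, ∀ N,
      (P N).real {ω | C < (X N ω).toMeasure.real (Ico (-k : ℝ) k)} ≤ ε)
    (tξ : ∀ (k : ℕ) (ε : ℝ), 0 < ε → ∃ C : ℝ,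
      P'.real {ω | C < (ξ ω).toMeasure.real (Ico (-k : ℝ) k)} ≤ ε)
    (hb : ∀ n, TendstoInDistribution (fun N ω => WithLp.toLp 2 (binMasses n (X N ω))) atTop
      (fun ω => WithLp.toLp 2 (binMasses n (ξ ω))) P P') :
    TendstoInDistribution X atTop ξ P P' := by
  have hXn : ∀ n N, AEMeasurable (fun ω => binMasses n (X N ω)) (P N) := fun n N =>
    (PiLp.continuous_ofLp 2 _).measurable.comp_aemeasurable ((hb n).forall_aemeasurable N)
  have hξn : ∀ n, AEMeasurable (fun ω => binMasses n (ξ ω)) P' := fun n =>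
    (PiLp.continuous_ofLp 2 _).measurable.comp_aemeasurable (hb n).aemeasurable_limit
  rw [tendstoInDistribution_iff_integral hX hξ]
  intro F
  have hF := F.continuous
  have hD : ∀ μ, |F μ| ≤ ‖F‖ := fun μ => F.norm_coe_le_norm μ
  have hconv : ∀ n, Tendsto (fun N => ∫ ω, F (ofBinMasses n (binMasses n (X N ω))) ∂(P N)) atTop
      (𝓝 (∫ ω, F (ofBinMasses n (binMasses n (ξ ω))) ∂P')) := fun n =>
    (tendstoInDistribution_iff_integral (hb n).forall_aemeasurable (hb n).aemeasurable_limit).1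
      (hb n) (F.compContinuous
        ⟨_, (continuous_ofBinMasses n).comp (PiLp.continuous_ofLp 2 _)⟩)
  rw [Metric.tendsto_atTop]
  intro ε hε
  -- Error budget: `ε/8 + ε/4` for each of the two discretizations and `ε/8` for the convergence at
  -- fixed `n`, in total `7ε/8`.
  set δ : ℝ := ε / 8 / (‖F‖ + 1) with hδdef
  have hδ : 0 < δ := by positivity
  have hδF : δ * (2 * ‖F‖) ≤ ε / 4 := by
    rw [hδdef, div_mul_eq_mul_div, div_le_iff₀ (by positivity)]
    nlinarith [norm_nonneg F]
  choose C₁ hC₁ using fun k : ℕ => tX k (δ / 2 / 2 ^ k) (by positivity)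
  choose C₂ hC₂ using fun k : ℕ => tξ k (δ / 2 / 2 ^ k) (by positivity)
  -- The mass bounds hold simultaneously for all `N` and for the limit, so `n` can be fixed before
  -- `N` grows.
  obtain ⟨n, hn⟩ := (eventually_forall_abs_comp_sub_comp_ofBinMasses_lt hF
    (fun k => max (C₁ k) (C₂ k)) (by positivity : 0 < ε / 8)).exists
  obtain ⟨N₀, hN₀⟩ := Metric.tendsto_atTop.1 (hconv n) (ε / 8) (by positivity)
  refine ⟨N₀, fun N hN => ?_⟩
  have h1 := abs_integral_comp_sub_integral_comp_ofBinMasses_le (hX N) (hXn n N) hF hD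
    (C := fun k => max (C₁ k) (C₂ k)) hδ.le (by positivity : 0 ≤ ε / 8)
    (fun k => by
      refine le_trans (measureReal_mono ?_) (hC₁ k N)
      intro ω hω
      rw [mem_ofPred_eq] at hω ⊢
      exact (le_max_left _ _).trans_lt hω)
    fun μ hμ => (hn μ hμ).le
  have h2 := abs_integral_comp_sub_integral_comp_ofBinMasses_le hξ (hξn n) hF hD
    (C := fun k => max (C₁ k) (C₂ k)) hδ.le (by positivity : 0 ≤ ε / 8)
    (fun k => by
      refine le_trans (measureReal_mono ?_) (hC₂ k)
      intro ω hω
      rw [mem_ofPred_eq] at hω ⊢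
      exact (le_max_right _ _).trans_lt hω)
    fun μ hμ => (hn μ hμ).le
  have h3 := hN₀ N hN
  rw [Real.dist_eq] at h3 ⊢
  rw [abs_lt] at h3 ⊢
  rw [abs_le] at h1 h2
  constructor <;> linarith

end LocFinMeasure

/-! ### Counts of independent points -/

/-- Factors are exchanged one at a time; the others stay in the unit disc. -/
theorem norm_prod_sub_prod_le_sum {ι : Type*} (s : Finset ι) {f g : ι → ℂ}
    (hf : ∀ i ∈ s, ‖f i‖ ≤ 1) (hg : ∀ i ∈ s, ‖g i‖ ≤ 1) :
    ‖∏ i ∈ s, f i - ∏ i ∈ s, g i‖ ≤ ∑ i ∈ s, ‖f i - g i‖ := by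
  classical
  induction s using Finset.induction_on with
  | empty => simp
  | insert a s ha ih =>
    rw [Finset.prod_insert ha, Finset.prod_insert ha, Finset.sum_insert ha]
    have h1 : ‖∏ i ∈ s, f i‖ ≤ 1 := by
      rw [norm_prod]
      exact Finset.prod_le_one (fun _ _ => norm_nonneg _)
        fun i hi => hf i (Finset.mem_insert_of_mem hi)
    have h2 := ih (fun i hi => hf i (Finset.mem_insert_of_mem hi))
      fun i hi => hg i (Finset.mem_insert_of_mem hi)
    calc ‖f a * ∏ i ∈ s, f i - g a * ∏ i ∈ s, g i‖
        = ‖(f a - g a) * ∏ i ∈ s, f i + g a * (∏ i ∈ s, f i - ∏ i ∈ s, g i)‖ := by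
          congr 1; ring
      _ ≤ ‖f a - g a‖ * ‖∏ i ∈ s, f i‖ + ‖g a‖ * ‖∏ i ∈ s, f i - ∏ i ∈ s, g i‖ := by
          rw [← norm_mul, ← norm_mul]
          exact norm_add_le _ _
      _ ≤ ‖f a - g a‖ * 1 + 1 * ‖∏ i ∈ s, f i - ∏ i ∈ s, g i‖ := by
          gcongr
          exact hg a (Finset.mem_insert_self _ _)
      _ ≤ _ := by linarith

/-- Each `1 + z` is compared with `exp z`, which also lies in the unit disc because `‖1 + z‖ ≤ 1`
forces `Re z ≤ 0`. The errors are at most `‖z‖² ≤ m ‖z‖` and add up to at most `m K`. -/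
theorem tendsto_prod_one_add_of_tendsto_sum {ι : ℕ → Type*} [∀ N, Fintype (ι N)]
    {z : (N : ℕ) → ι N → ℂ} {L : ℂ} {K : ℝ} {m : ℕ → ℝ}
    (hz : ∀ N i, ‖1 + z N i‖ ≤ 1) (hL : Tendsto (fun N => ∑ i, z N i) atTop (𝓝 L))
    (hK : ∀ᶠ N in atTop, ∑ i, ‖z N i‖ ≤ K) (hm : Tendsto m atTop (𝓝 0))
    (hzm : ∀ᶠ N in atTop, ∀ i, ‖z N i‖ ≤ m N) :
    Tendsto (fun N => ∏ i, (1 + z N i)) atTop (𝓝 (Complex.exp L)) := by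
  have hexp : Tendsto (fun N => ∏ i, Complex.exp (z N i)) atTop (𝓝 (Complex.exp L)) := by
    simp_rw [← Complex.exp_sum]
    exact (Complex.continuous_exp.tendsto L).comp hL
  suffices h : Tendsto (fun N => ∏ i, (1 + z N i) - ∏ i, Complex.exp (z N i)) atTop (𝓝 0) by
    simpa using h.add hexp
  refine squeeze_zero_norm' (a := fun N => |m N| * K) ?_ (by simpa using hm.abs.mul_const K)
  filter_upwards [hK, hzm, hm.eventually_le_const one_pos] with N hKN hmN hm1
  have hre : ∀ i, ‖Complex.exp (z N i)‖ ≤ 1 := by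
    intro i
    rw [Complex.norm_exp, Real.exp_le_one_iff]
    have := (Complex.re_le_norm _).trans (hz N i)
    simp only [Complex.add_re, Complex.one_re] at this
    linarith
  calc _ ≤ ∑ i, ‖(1 + z N i) - Complex.exp (z N i)‖ :=
        norm_prod_sub_prod_le_sum _ (fun i _ => hz N i) fun i _ => hre i
    _ ≤ ∑ i, |m N| * ‖z N i‖ := by
        refine Finset.sum_le_sum fun i _ => ?_
        rw [norm_sub_rev, ← sub_sub]
        refine (Complex.norm_exp_sub_one_sub_id_le ((hmN i).trans hm1)).trans ?_
        rw [sq]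
        exact mul_le_mul_of_nonneg_right ((hmN i).trans (le_abs_self _)) (norm_nonneg _)
    _ = |m N| * ∑ i, ‖z N i‖ := by rw [Finset.mul_sum]
    _ ≤ _ := mul_le_mul_of_nonneg_left hKN (abs_nonneg _)

theorem measurable_toLp_indicator {κ : Type*} [Fintype κ] {B : κ → Set ℝ}
    (hB : ∀ j, MeasurableSet (B j)) :
    Measurable fun x : ℝ => (WithLp.toLp 2 fun j => (B j).indicator (fun _ => (1 : ℝ)) x :
      EuclideanSpace ℝ κ) :=
  (PiLp.continuous_toLp 2 _).measurable.comp
    (measurable_pi_iff.2 fun j => measurable_const.indicator (hB j))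

/-- By disjointness at most one indicator is nonzero, so the exponential of the linear form is
affine in the indicators. -/
theorem charFun_map_toLp_indicator {κ Ω : Type*} [Fintype κ] [MeasurableSpace Ω] {P : Measure Ω}
    [IsProbabilityMeasure P] {Z : Ω → ℝ} (hZ : AEMeasurable Z P) {B : κ → Set ℝ}
    (hB : ∀ j, MeasurableSet (B j)) (hd : Pairwise fun i j => Disjoint (B i) (B j))
    (s : EuclideanSpace ℝ κ) :
    charFun (P.map fun ω => (WithLp.toLp 2 fun j => (B j).indicator (fun _ => (1 : ℝ)) (Z ω) :
      EuclideanSpace ℝ κ)) s =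
      1 + ∑ j, ((P.map Z).real (B j) : ℂ) * (Complex.exp (s j * Complex.I) - 1) := by
  classical
  have := Measure.isProbabilityMeasure_map hZ
  have hpt : ∀ x : ℝ, Complex.exp ((inner ℝ (WithLp.toLp 2 fun j =>
      (B j).indicator (fun _ => (1 : ℝ)) x : EuclideanSpace ℝ κ) s : ℝ) * Complex.I) =
      1 + ∑ j, (B j).indicator (fun _ => Complex.exp (s j * Complex.I) - 1) x := by
    intro x
    have hin : inner ℝ (WithLp.toLp 2 fun j =>
        (B j).indicator (fun _ => (1 : ℝ)) x : EuclideanSpace ℝ κ) s =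
        ∑ j, (B j).indicator (fun _ => s j) x := by
      rw [PiLp.inner_apply]
      refine Finset.sum_congr rfl fun j _ => ?_
      by_cases hx : x ∈ B j <;> simp [hx]
    rw [hin]
    by_cases hx : ∃ j, x ∈ B j
    · obtain ⟨j, hj⟩ := hx
      have hne : ∀ i, i ≠ j → x ∉ B i := fun i hij hi => Set.disjoint_left.1 (hd hij) hi hj
      rw [Finset.sum_eq_single j (fun i _ hij => indicator_of_notMem (hne i hij) _) (by simp),
        Finset.sum_eq_single j (fun i _ hij => indicator_of_notMem (hne i hij) _) (by simp),
        indicator_of_mem hj, indicator_of_mem hj]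
      ring
    · push Not at hx
      rw [Finset.sum_eq_zero fun i _ => indicator_of_notMem (hx i) _,
        Finset.sum_eq_zero fun i _ => indicator_of_notMem (hx i) _]
      simp
  have hmeas := measurable_toLp_indicator hB
  rw [show (fun ω => (WithLp.toLp 2 fun j => (B j).indicator (fun _ => (1 : ℝ)) (Z ω) :
      EuclideanSpace ℝ κ)) = (fun x : ℝ => (WithLp.toLp 2 fun j =>
      (B j).indicator (fun _ => (1 : ℝ)) x : EuclideanSpace ℝ κ)) ∘ Z from rfl,
    ← AEMeasurable.map_map_of_aemeasurable hmeas.aemeasurable hZ, charFun_apply,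
    integral_map hmeas.aemeasurable (by fun_prop)]
  simp_rw [hpt]
  have hint : ∀ j, Integrable ((B j).indicator fun _ => Complex.exp (s j * Complex.I) - 1)
      (P.map Z) := fun j => (integrable_const _).indicator (hB j)
  rw [integral_add (integrable_const _) (integrable_finsetSum _ fun j _ => hint j),
    integral_finsetSum _ fun j _ => hint j]
  congr 1
  · simp
  · refine Finset.sum_congr rfl fun j _ => ?_
    rw [integral_indicator_const _ (hB j), Complex.real_smul]

/-- Poisson limit theorem for the numbers of points in disjoint sets, in a triangular array of
independent points. -/
theorem tendstoInDistribution_sum_indicator {κ : Type*} [Fintype κ]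
    {ι : ℕ → Type*} [∀ N, Fintype (ι N)] {Ω : ℕ → Type*} [∀ N, MeasurableSpace (Ω N)]
    {P : (N : ℕ) → Measure (Ω N)} [∀ N, IsProbabilityMeasure (P N)]
    {Ω' : Type*} [MeasurableSpace Ω'] {P' : Measure Ω'} [IsProbabilityMeasure P']
    {Z : (N : ℕ) → ι N → Ω N → ℝ} (hZ : ∀ N i, AEMeasurable (Z N i) (P N))
    (hind : ∀ N, iIndepFun (Z N) (P N)) {B : κ → Set ℝ} (hB : ∀ j, MeasurableSet (B j))
    (hd : Pairwise fun i j => Disjoint (B i) (B j)) {r : κ → ℝ}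
    (hr : ∀ j, Tendsto (fun N => ∑ i, ((P N).map (Z N i)).real (B j)) atTop (𝓝 (r j)))
    {m : ℕ → ℝ} (hm : Tendsto m atTop (𝓝 0))
    (hmB : ∀ j, ∀ᶠ N in atTop, ∀ i, ((P N).map (Z N i)).real (B j) ≤ m N)
    {W : Ω' → EuclideanSpace ℝ κ} (hW : AEMeasurable W P')
    (hWr : ∀ s : EuclideanSpace ℝ κ, charFun (P'.map W) s =
      Complex.exp (∑ j, (r j : ℂ) * (Complex.exp (s j * Complex.I) - 1))) :
    TendstoInDistribution (fun N ω => (WithLp.toLp 2 fun j =>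
      ∑ i, (B j).indicator (fun _ => (1 : ℝ)) (Z N i ω) : EuclideanSpace ℝ κ)) atTop W P P' := by
  have hV : ∀ N i, AEMeasurable (fun ω => (WithLp.toLp 2 fun j =>
      (B j).indicator (fun _ => (1 : ℝ)) (Z N i ω) : EuclideanSpace ℝ κ)) (P N) := fun N i =>
    (measurable_toLp_indicator hB).comp_aemeasurable (hZ N i)
  have hsum : ∀ N, (fun ω => (WithLp.toLp 2 fun j =>
      ∑ i, (B j).indicator (fun _ => (1 : ℝ)) (Z N i ω) : EuclideanSpace ℝ κ)) =
      fun ω => ∑ i, (WithLp.toLp 2 fun j =>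
        (B j).indicator (fun _ => (1 : ℝ)) (Z N i ω) : EuclideanSpace ℝ κ) := by
    intro N
    ext ω j
    simp
  have hmeas : ∀ N, AEMeasurable (fun ω => (WithLp.toLp 2 fun j =>
      ∑ i, (B j).indicator (fun _ => (1 : ℝ)) (Z N i ω) : EuclideanSpace ℝ κ)) (P N) := by
    intro N
    rw [hsum]
    exact Finset.aemeasurable_fun_sum _ fun i _ => hV N i
  refine ⟨hmeas, hW, ProbabilityMeasure.tendsto_iff_tendsto_charFun.2 fun s => ?_⟩
  change Tendsto (fun N => charFun ((P N).map _) s) atTop (𝓝 (charFun (P'.map W) s))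
  rw [hWr]
  set c : κ → ℂ := fun j => Complex.exp (s j * Complex.I) - 1 with hc
  have hc2 : ∀ j, ‖c j‖ ≤ 2 := by
    intro j
    refine (norm_sub_le _ _).trans ?_
    rw [Complex.norm_exp_ofReal_mul_I, norm_one]
    norm_num
  have hchar : ∀ N, charFun ((P N).map fun ω => (WithLp.toLp 2 fun j =>
      ∑ i, (B j).indicator (fun _ => (1 : ℝ)) (Z N i ω) : EuclideanSpace ℝ κ)) s =
      ∏ i, (1 + ∑ j, (((P N).map (Z N i)).real (B j) : ℂ) * c j) := by
    intro N
    have hindV : iIndepFun (fun i ω => (WithLp.toLp 2 fun j =>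
        (B j).indicator (fun _ => (1 : ℝ)) (Z N i ω) : EuclideanSpace ℝ κ)) (P N) :=
      (hind N).comp _ fun _ => measurable_toLp_indicator hB
    rw [hsum, hindV.charFun_map_fun_sum_eq_prod (hV N), Finset.prod_apply]
    exact Finset.prod_congr rfl fun i _ => charFun_map_toLp_indicator (hZ N i) hB hd s
  have hnorm : ∀ N i, ‖∑ j, (((P N).map (Z N i)).real (B j) : ℂ) * c j‖ ≤
      ∑ j, ((P N).map (Z N i)).real (B j) * 2 := by
    intro N i
    refine norm_sum_le_of_le _ fun j _ => ?_
    rw [norm_mul, Complex.norm_real, Real.norm_of_nonneg measureReal_nonneg]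
    exact mul_le_mul_of_nonneg_left (hc2 j) measureReal_nonneg
  refine Tendsto.congr (fun N => (hchar N).symm) (tendsto_prod_one_add_of_tendsto_sum
    (K := ∑ j, r j * 2 + 1) (m := fun N => ∑ _j : κ, m N * 2) ?_ ?_ ?_ ?_ ?_)
  · intro N i
    rw [← charFun_map_toLp_indicator (hZ N i) hB hd s]
    have := Measure.isProbabilityMeasure_map (hV N i)
    exact norm_charFun_le_one s
  · simp_rw [Finset.sum_comm (s := (Finset.univ : Finset (ι _))), ← Finset.sum_mul]
    refine tendsto_finsetSum _ fun j _ => Tendsto.mul_const _ ?_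
    have := (Complex.continuous_ofReal.tendsto (r j)).comp (hr j)
    refine this.congr fun N => ?_
    simp
  · have : Tendsto (fun N => ∑ j, (∑ i, ((P N).map (Z N i)).real (B j)) * 2) atTop
        (𝓝 (∑ j, r j * 2)) := tendsto_finsetSum _ fun j _ => (hr j).mul_const 2
    filter_upwards [this.eventually_le_const (lt_add_one _)] with N hN
    refine le_trans ?_ hN
    simp_rw [Finset.sum_mul]
    rw [Finset.sum_comm]
    exact Finset.sum_le_sum fun i _ => hnorm N i
  · have := tendsto_finsetSum (Finset.univ : Finset κ) fun j _ => hm.mul_const 2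
    simpa using this
  · filter_upwards [eventually_all.2 hmB] with N hN i
    exact (hnorm N i).trans (Finset.sum_le_sum fun j _ => by linarith [hN j i])

/-! ### The maximizer `tStar` -/

/-- Gives access to the positivity and end-point values of `Real.binEntropy`. -/
theorem cramerEntropy_eq_log_two_sub_binEntropy (t : ℝ) :
    cramerEntropy t = Real.log 2 - Real.binEntropy ((1 + t) / 2) := by
  have key : ∀ x : ℝ, x / 2 * Real.log (x / 2) = x * Real.log x / 2 - x / 2 * Real.log 2 := by
    intro x
    rcases eq_or_ne x 0 with rfl | hx
    · simp
    · rw [Real.log_div hx two_ne_zero]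
      ring
  have e : 1 - (1 + t) / 2 = (1 - t) / 2 := by ring
  rw [Real.binEntropy, Real.log_inv, Real.log_inv, e, mul_neg, mul_neg, key, key, cramerEntropy]
  ring

theorem rhoFun_eq_sqrt_binEntropy (t : ℝ) :
    rhoFun t = √(2 * Real.binEntropy ((1 + t) / 2)) := by
  rw [rhoFun, cramerEntropy_eq_log_two_sub_binEntropy]
  congr 2
  ring

theorem binEntropy_half_pos {t : ℝ} (ht : t ∈ Ioo (-1 : ℝ) 1) :
    0 < Real.binEntropy ((1 + t) / 2) :=
  Real.binEntropy_pos (by linarith [ht.1]) (by linarith [ht.2])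

theorem rhoFun_pos {t : ℝ} (ht : t ∈ Ioo (-1 : ℝ) 1) : 0 < rhoFun t := by
  rw [rhoFun_eq_sqrt_binEntropy]
  have := binEntropy_half_pos ht
  positivity

theorem sq_rhoFun {t : ℝ} (ht : t ∈ Ioo (-1 : ℝ) 1) :
    rhoFun t ^ 2 = 2 * (Real.log 2 - cramerEntropy t) := by
  have := binEntropy_half_pos ht
  rw [rhoFun, Real.sq_sqrt]
  rw [cramerEntropy_eq_log_two_sub_binEntropy]
  linarith

theorem hasDerivAt_cramerEntropy {t : ℝ} (ht : t ∈ Ioo (-1 : ℝ) 1) :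
    HasDerivAt cramerEntropy ((Real.log (1 + t) - Real.log (1 - t)) / 2) t := by
  have h1 : (1 : ℝ) - t ≠ 0 := by linarith [ht.2]
  have h2 : (1 : ℝ) + t ≠ 0 := by linarith [ht.1]
  have d1 : HasDerivAt (fun t : ℝ => 1 - t) (-1) t := by
    simpa using (hasDerivAt_id t).const_sub 1
  have d2 : HasDerivAt (fun t : ℝ => 1 + t) 1 t := by
    simpa using (hasDerivAt_id t).const_add 1
  have := ((d1.mul (d1.log h1)).add (d2.mul (d2.log h2))).div_const 2
  refine this.congr_deriv ?_
  field_simp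
  ring

theorem iteratedDeriv_two_cramerEntropy {t : ℝ} (ht : t ∈ Ioo (-1 : ℝ) 1) :
    iteratedDeriv 2 cramerEntropy t = 1 / (1 - t ^ 2) := by
  have h1 : (1 : ℝ) - t ≠ 0 := by linarith [ht.2]
  have h2 : (1 : ℝ) + t ≠ 0 := by linarith [ht.1]
  have d1 : HasDerivAt (fun t : ℝ => 1 - t) (-1) t := by
    simpa using (hasDerivAt_id t).const_sub 1
  have d2 : HasDerivAt (fun t : ℝ => 1 + t) 1 t := by
    simpa using (hasDerivAt_id t).const_add 1
  have hev : deriv cramerEntropy =ᶠ[𝓝 t]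
      fun t => (Real.log (1 + t) - Real.log (1 - t)) / 2 := by
    filter_upwards [isOpen_Ioo.mem_nhds ht] with s hs
    exact (hasDerivAt_cramerEntropy hs).deriv
  rw [iteratedDeriv_succ, iteratedDeriv_one, hev.deriv_eq]
  refine HasDerivAt.deriv ((((d2.log h2).sub (d1.log h1)).div_const 2).congr_deriv ?_)
  rw [show 1 - t ^ 2 = (1 - t) * (1 + t) by ring]
  field_simp
  ring

/-- The slope of `ρ` is infinite at `1`: `ρ(1 - 2ε)² ≥ 2ε log (1/ε)`, which beats the square of the
linear loss `2hε`. The resulting strict inequality `h < M(h)` keeps the maximizer off both end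
points and all Gaussian levels of order `√N`. -/
theorem exists_lt_rhoFun_add (h : ℝ) :
    ∃ t ∈ Icc (-1 : ℝ) 1, h < rhoFun t + h * t := by
  -- Chosen so that `log (1/ε) = 2h² + 1`, whence `ρ² ≥ 2ε(2h² + 1) > 4h²ε ≥ (2hε)²`.
  set ε : ℝ := Real.exp (-(2 * h ^ 2 + 1)) with hε
  have hε0 : 0 < ε := Real.exp_pos _
  have hε1 : ε < 1 := by
    rw [hε, Real.exp_lt_one_iff]
    nlinarith [sq_nonneg h]
  have hlog : Real.log ε⁻¹ = 2 * h ^ 2 + 1 := by rw [Real.log_inv, hε, Real.log_exp, neg_neg]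
  have hmem : 1 - 2 * ε ∈ Icc (-1 : ℝ) 1 := ⟨by linarith, by linarith⟩
  refine ⟨1 - 2 * ε, hmem, ?_⟩
  have hent : ε * (2 * h ^ 2 + 1) ≤ Real.binEntropy ((1 + (1 - 2 * ε)) / 2) := by
    rw [show (1 + (1 - 2 * ε)) / 2 = 1 - ε by ring, Real.binEntropy_one_sub, Real.binEntropy, hlog]
    have : 0 ≤ Real.log (1 - ε)⁻¹ := Real.log_nonneg ((one_le_inv₀ (by linarith)).2 (by linarith))
    nlinarith
  have hlt : 2 * h * ε < rhoFun (1 - 2 * ε) := by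
    rw [rhoFun_eq_sqrt_binEntropy]
    refine Real.lt_sqrt_of_sq_lt ?_
    have : (2 * h * ε) ^ 2 ≤ 4 * h ^ 2 * ε := by
      nlinarith [mul_nonneg (mul_nonneg (sq_nonneg h) hε0.le) (sub_nonneg.2 hε1.le)]
    nlinarith
  linarith

theorem maxEnergy_eq (h : ℝ) : maxEnergy h = rhoFun (tStar h) + h * tStar h := by
  refine IsGreatest.csSup_eq ⟨mem_image_of_mem _ (tStar_mem h), ?_⟩
  rintro _ ⟨t, ht, rfl⟩
  exact tStar_isMaxOn h ht

theorem lt_maxEnergy (h : ℝ) : h < maxEnergy h := by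
  obtain ⟨t, ht, hlt⟩ := exists_lt_rhoFun_add h
  rw [maxEnergy_eq]
  exact hlt.trans_le (tStar_isMaxOn h ht)

theorem tStar_mem_Ioo {h : ℝ} (hh : 0 ≤ h) : tStar h ∈ Ioo (-1 : ℝ) 1 := by
  have hmem := tStar_mem h
  have hM := lt_maxEnergy h
  rw [maxEnergy_eq] at hM
  refine ⟨lt_of_le_of_ne hmem.1 fun he => ?_, lt_of_le_of_ne hmem.2 fun he => ?_⟩
  · rw [← he, rhoFun_eq_sqrt_binEntropy] at hM
    norm_num at hM
    linarith
  · rw [he, rhoFun_eq_sqrt_binEntropy] at hM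
    norm_num at hM

/-- The critical point equation `I'(t_*) = h ρ(t_*)`, from `ρ' = -I'/ρ`. -/
theorem log_sub_log_tStar {h : ℝ} (hh : 0 ≤ h) :
    Real.log (1 + tStar h) - Real.log (1 - tStar h) = 2 * (h * rhoFun (tStar h)) := by
  have ht := tStar_mem_Ioo hh
  have hpos := rhoFun_pos ht
  have hloc : IsLocalMax (fun t => rhoFun t + h * t) (tStar h) :=
    (tStar_isMaxOn h).isLocalMax (Icc_mem_nhds ht.1 ht.2)
  have hne : 2 * (Real.log 2 - cramerEntropy (tStar h)) ≠ 0 := by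
    rw [← sq_rhoFun ht]
    positivity
  have hd := ((((hasDerivAt_cramerEntropy ht).const_sub (Real.log 2)).const_mul 2).sqrt hne).add
    ((hasDerivAt_id (tStar h)).const_mul h)
  have h0 := hloc.hasDerivAt_eq_zero hd
  change 2 * -((Real.log (1 + tStar h) - Real.log (1 - tStar h)) / 2) / (2 * rhoFun (tStar h))
    + h * 1 = 0 at h0
  field_simp at h0
  linarith

/-- Since `ρ²/2 = log 2 - I`, the critical point equation puts the coin probabilities at `t_*` in
the exponential form found in the Gaussian density. -/
theorem half_one_add_tStar {h : ℝ} (hh : 0 ≤ h) : (1 + tStar h) / 2 =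
    Real.exp (-rhoFun (tStar h) ^ 2 / 2 + h * rhoFun (tStar h) * (1 - tStar h)) := by
  have ht := tStar_mem_Ioo hh
  have hl := log_sub_log_tStar hh
  have h2 : (0 : ℝ) < 1 + tStar h := by linarith [ht.1]
  rw [← Real.exp_log (by linarith : 0 < (1 + tStar h) / 2), Real.log_div h2.ne' two_ne_zero,
    sq_rhoFun ht, cramerEntropy]
  congr 1
  linear_combination (1 - tStar h) / 2 * hl

theorem half_one_sub_tStar {h : ℝ} (hh : 0 ≤ h) : (1 - tStar h) / 2 =
    Real.exp (-rhoFun (tStar h) ^ 2 / 2 + h * rhoFun (tStar h) * (-1 - tStar h)) := by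
  have ht := tStar_mem_Ioo hh
  have hl := log_sub_log_tStar hh
  have h2 : (0 : ℝ) < 1 - tStar h := by linarith [ht.2]
  rw [← Real.exp_log (by linarith : 0 < (1 - tStar h) / 2), Real.log_div h2.ne' two_ne_zero,
    sq_rhoFun ht, cramerEntropy]
  congr 1
  linear_combination -(1 + tStar h) / 2 * hl

/-! ### Gaussian estimates -/

/-- The tail of the standard Gaussian distribution. -/
noncomputable def gaussianTail (y : ℝ) : ℝ := (gaussianReal 0 1).real (Ici y)

theorem sqrt_two_pi_mul_gaussianTail (y : ℝ) :
    √(2 * Real.pi) * gaussianTail y = ∫ x in Ioi y, Real.exp (-x ^ 2 / 2) := by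
  rw [gaussianTail, measureReal_def, gaussianReal_apply_eq_integral 0 one_ne_zero,
    ENNReal.toReal_ofReal (integral_nonneg fun x => gaussianPDFReal_nonneg 0 1 x),
    integral_Ici_eq_integral_Ioi, ← integral_const_mul]
  refine integral_congr_ae (ae_of_all _ fun x => ?_)
  simp only [gaussianPDFReal, NNReal.coe_one, mul_one, sub_zero]
  rw [mul_inv_cancel_left₀ (by positivity)]

theorem integrable_exp_neg_sq_div_two : Integrable fun x : ℝ => Real.exp (-x ^ 2 / 2) := by
  have := integrable_exp_neg_mul_sq (by norm_num : (0 : ℝ) < 1 / 2)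
  refine this.congr (ae_of_all _ fun x => ?_)
  simp only
  congr 1
  ring

/-- The integrand is the exact derivative of `-exp (-x²/2) / x`. Its extra factor lies between `1`
and `1 + 1/y²` for `x > y`, which sandwiches the Gaussian tail. -/
theorem integral_Ioi_exp_neg_sq_mul {y : ℝ} (hy : 0 < y) :
    IntegrableOn (fun x => Real.exp (-x ^ 2 / 2) * (1 + 1 / x ^ 2)) (Ioi y) ∧
    ∫ x in Ioi y, Real.exp (-x ^ 2 / 2) * (1 + 1 / x ^ 2) = Real.exp (-y ^ 2 / 2) / y := by
  have hd : ∀ x ∈ Ici y, HasDerivAt (fun x : ℝ => -(Real.exp (-x ^ 2 / 2) / x))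
      (Real.exp (-x ^ 2 / 2) * (1 + 1 / x ^ 2)) x := by
    intro x hx
    have hx0 : x ≠ 0 := (hy.trans_le hx).ne'
    have h1 : HasDerivAt (fun x : ℝ => -x ^ 2 / 2) (-x) x :=
      ((hasDerivAt_pow 2 x).neg.div_const 2).congr_deriv (by norm_num; ring)
    refine (h1.exp.div (hasDerivAt_id x) hx0).neg.congr_deriv ?_
    simp only [id]
    field_simp
    ring
  have hpos : ∀ x ∈ Ioi y, 0 ≤ Real.exp (-x ^ 2 / 2) * (1 + 1 / x ^ 2) := fun x _ => by positivity
  have hlim : Tendsto (fun x : ℝ => -(Real.exp (-x ^ 2 / 2) / x)) atTop (𝓝 0) := by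
    rw [← neg_zero]
    refine Tendsto.neg (squeeze_zero' ?_ ?_ tendsto_inv_atTop_zero)
    · filter_upwards [eventually_gt_atTop 0] with x hx
      positivity
    · filter_upwards [eventually_gt_atTop 0] with x hx
      rw [div_eq_mul_inv]
      refine mul_le_of_le_one_left (by positivity) ?_
      rw [Real.exp_le_one_iff]
      nlinarith [sq_nonneg x]
  refine ⟨integrableOn_Ioi_deriv_of_nonneg' hd hpos hlim, ?_⟩
  rw [integral_Ioi_of_hasDerivAt_of_nonneg' hd hpos hlim]
  ring

/-- The ratio of the Gaussian tail to its leading asymptotic term. -/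
noncomputable def millsRatio (y : ℝ) : ℝ :=
  √(2 * Real.pi) * y * Real.exp (y ^ 2 / 2) * gaussianTail y

theorem gaussianTail_eq_millsRatio {y : ℝ} (hy : 0 < y) :
    gaussianTail y = millsRatio y * Real.exp (-y ^ 2 / 2) / (√(2 * Real.pi) * y) := by
  have : Real.exp (y ^ 2 / 2) * Real.exp (-y ^ 2 / 2) = 1 := by
    rw [← Real.exp_add, Real.exp_eq_one_iff]
    ring
  rw [millsRatio, eq_div_iff (by positivity)]
  linear_combination -(√(2 * Real.pi) * y * gaussianTail y) * this

/-- The sandwich reads `1 / (1 + 1/y²) ≤ millsRatio y ≤ 1`. -/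
theorem abs_millsRatio_sub_one_le {y : ℝ} (hy : 0 < y) : |millsRatio y - 1| ≤ 1 / y ^ 2 := by
  obtain ⟨hint, heq⟩ := integral_Ioi_exp_neg_sq_mul hy
  have e : Real.exp (y ^ 2 / 2) * Real.exp (-y ^ 2 / 2) = 1 := by
    rw [← Real.exp_add, Real.exp_eq_one_iff]
    ring
  have hI := sqrt_two_pi_mul_gaussianTail y
  have hm : millsRatio y = y * Real.exp (y ^ 2 / 2) * ∫ x in Ioi y, Real.exp (-x ^ 2 / 2) := by
    rw [← hI, millsRatio]
    ring
  have h1 : y * Real.exp (y ^ 2 / 2) *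
      ∫ x in Ioi y, Real.exp (-x ^ 2 / 2) * (1 + 1 / x ^ 2) = 1 := by
    rw [heq]
    rw [mul_div_assoc', div_eq_one_iff_eq hy.ne', mul_assoc, e, mul_one]
  have hle : millsRatio y ≤ 1 := by
    rw [hm, ← h1]
    refine mul_le_mul_of_nonneg_left (setIntegral_mono_on integrable_exp_neg_sq_div_two.integrableOn
      hint measurableSet_Ioi fun x _ => ?_) (by positivity)
    exact le_mul_of_one_le_right (Real.exp_pos _).le (le_add_of_nonneg_right (by positivity))
  have hge : 1 ≤ millsRatio y * (1 + 1 / y ^ 2) := by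
    rw [hm, mul_assoc, ← integral_mul_const]
    refine h1.symm.le.trans ?_
    refine mul_le_mul_of_nonneg_left (setIntegral_mono_on hint
      (integrable_exp_neg_sq_div_two.integrableOn.mul_const _) measurableSet_Ioi fun x hx => ?_)
      (by positivity)
    have : y < x := hx
    gcongr
  have hy2 : 0 < 1 / y ^ 2 := by positivity
  rw [abs_le]
  constructor <;> nlinarith

theorem gaussianTail_nonneg (y : ℝ) : 0 ≤ gaussianTail y := measureReal_nonneg

theorem gaussianTail_anti {y z : ℝ} (h : y ≤ z) : gaussianTail z ≤ gaussianTail y :=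
  measureReal_mono (Ici_subset_Ici.2 h)

theorem tendsto_measureReal_Ici_atTop (μ : Measure ℝ) [IsFiniteMeasure μ] :
    Tendsto (fun y => μ.real (Ici y)) atTop (𝓝 0) := by
  have h := tendsto_measure_iInter_atTop (μ := μ) (s := fun y : ℝ => Ici y)
    (fun y => measurableSet_Ici.nullMeasurableSet) (fun _ _ h => Ici_subset_Ici.2 h)
    ⟨0, measure_ne_top _ _⟩
  have he : ⋂ y : ℝ, Ici y = ∅ := by
    ext x
    simpa using exists_gt x
  rw [he, measure_empty] at h
  have := (ENNReal.tendsto_toReal ENNReal.zero_ne_top).comp h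
  rwa [ENNReal.toReal_zero] at this

theorem tendsto_gaussianTail_atTop : Tendsto gaussianTail atTop (𝓝 0) :=
  tendsto_measureReal_Ici_atTop _

/-- With `v = 1 - t_*²` this is the constant produced by the central limit theorem. -/
theorem integral_exp_neg_sq_gaussianReal (h : ℝ) {v : ℝ} (hv : 0 < v) :
    ∫ x, Real.exp (-(h * x) ^ 2 / 2) ∂(gaussianReal 0 v.toNNReal) = (√(1 + h ^ 2 * v))⁻¹ := by
  rw [integral_gaussianReal_eq_integral_smul (by simpa using hv)]
  have hb : 0 < h ^ 2 / 2 + 1 / (2 * v) := by positivity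
  have : ∀ x : ℝ, gaussianPDFReal 0 v.toNNReal x • Real.exp (-(h * x) ^ 2 / 2) =
      (√(2 * Real.pi * v))⁻¹ * Real.exp (-(h ^ 2 / 2 + 1 / (2 * v)) * x ^ 2) := by
    intro x
    rw [gaussianPDFReal, Real.coe_toNNReal _ hv.le, smul_eq_mul, mul_assoc, ← Real.exp_add]
    congr 2
    field_simp
    ring
  simp_rw [this]
  rw [integral_const_mul, integral_gaussian, ← Real.sqrt_inv, ← Real.sqrt_mul (by positivity),
    ← Real.sqrt_inv]
  congr 1
  field_simp
  ring

/-- The derivative is bounded by `1` because `|x| ≤ 1 + x²/2 ≤ exp (x²/2)`. -/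
theorem abs_exp_neg_sq_sub_le (a b : ℝ) :
    |Real.exp (-a ^ 2 / 2) - Real.exp (-b ^ 2 / 2)| ≤ |a - b| := by
  have hd : ∀ x : ℝ, HasDerivAt (fun x : ℝ => Real.exp (-x ^ 2 / 2))
      (Real.exp (-x ^ 2 / 2) * -x) x := fun x =>
    (((hasDerivAt_pow 2 x).neg.div_const 2).congr_deriv (by norm_num; ring) :
      HasDerivAt (fun x : ℝ => -x ^ 2 / 2) (-x) x).exp
  have hb : ∀ x : ℝ, ‖Real.exp (-x ^ 2 / 2) * -x‖ ≤ 1 := by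
    intro x
    rw [norm_mul, Real.norm_of_nonneg (Real.exp_pos _).le, norm_neg, Real.norm_eq_abs, neg_div,
      Real.exp_neg, inv_mul_le_iff₀ (Real.exp_pos _), mul_one]
    have h1 := Real.add_one_le_exp (x ^ 2 / 2)
    have h2 : |x| ≤ x ^ 2 / 2 + 1 := by
      rw [← sq_abs]
      nlinarith [sq_nonneg (|x| - 1)]
    linarith
  have := Convex.norm_image_sub_le_of_norm_hasDerivWithin_le (s := univ) (x := b) (y := a)
    (fun x _ => (hd x).hasDerivWithinAt) (fun x _ => hb x) convex_univ trivial trivial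
  simpa using this

/-! ### Biased coins -/

instance : MeasurableSingletonClass ℤˣ where
  measurableSet_singleton u := by
    have : ({u} : Set ℤˣ) = Units.val ⁻¹' {(u : ℤ)} := by
      ext w
      simp [Units.ext_iff]
    rw [this]
    exact ⟨_, measurableSet_singleton _, rfl⟩

/-- The probability of the value `s` for a coin with mean `t`. -/
noncomputable def coinWeight (t : ℝ) (s : ℤˣ) : ℝ := (1 + ((s : ℤ) : ℝ) * t) / 2

/-- The law of a coin with mean `t`. -/
noncomputable def coinMeasure (t : ℝ) : Measure ℤˣ :=
  ENNReal.ofReal (coinWeight t 1) • Measure.dirac 1 +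
    ENNReal.ofReal (coinWeight t (-1)) • Measure.dirac (-1)

theorem coinWeight_nonneg {t : ℝ} (ht : t ∈ Ioo (-1 : ℝ) 1) (s : ℤˣ) : 0 ≤ coinWeight t s := by
  rcases Int.units_eq_one_or s with rfl | rfl <;> simp [coinWeight] <;> linarith [ht.1, ht.2]

theorem coinMeasure_singleton (t : ℝ) (s : ℤˣ) :
    coinMeasure t {s} = ENNReal.ofReal (coinWeight t s) := by
  rcases Int.units_eq_one_or s with rfl | rfl <;> simp [coinMeasure]

theorem isProbabilityMeasure_coinMeasure {t : ℝ} (ht : t ∈ Ioo (-1 : ℝ) 1) :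
    IsProbabilityMeasure (coinMeasure t) := by
  constructor
  simp only [coinMeasure, Measure.add_apply, Measure.smul_apply, measure_univ, smul_eq_mul, mul_one]
  rw [← ENNReal.ofReal_add (coinWeight_nonneg ht _) (coinWeight_nonneg ht _),
    ENNReal.ofReal_eq_one]
  simp [coinWeight]
  ring

theorem integral_coinMeasure {t : ℝ} (ht : t ∈ Ioo (-1 : ℝ) 1) (f : ℤˣ → ℝ) :
    ∫ s, f s ∂coinMeasure t = coinWeight t 1 * f 1 + coinWeight t (-1) * f (-1) := by
  have := isProbabilityMeasure_coinMeasure ht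
  have hu : (Finset.univ : Finset ℤˣ) = {1, -1} := by decide
  rw [integral_fintype .of_finite, hu, Finset.sum_pair (by decide)]
  simp only [measureReal_def, coinMeasure_singleton, ENNReal.toReal_ofReal (coinWeight_nonneg ht _),
    smul_eq_mul]

/-- The total magnetization of a configuration. -/
noncomputable def spinSum {N : ℕ} (σ : Hypercube N) : ℝ := ∑ i, ((σ i : ℤ) : ℝ)

/-- Translates results on independent random variables into statements about weighted sums over the
hypercube. -/
theorem integral_coins {t : ℝ} (ht : t ∈ Ioo (-1 : ℝ) 1) {Ω : Type*} [MeasurableSpace Ω]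
    {P : Measure Ω} {X : ℕ → Ω → ℤˣ}
    (hX : ∀ k, HasLaw (X k) (coinMeasure t) P) (hind : iIndepFun X P) (N : ℕ)
    (f : Hypercube N → ℝ) :
    ∫ ω, f (fun i => X i ω) ∂P = ∑ σ : Hypercube N, (∏ i, coinWeight t (σ i)) * f σ := by
  have := isProbabilityMeasure_coinMeasure ht
  have hindN : iIndepFun (fun (i : Fin N) ω => X i ω) P := hind.precomp Fin.val_injective
  have hm : ∀ i : Fin N, AEMeasurable (X i) P := fun i => (hX i).aemeasurable
  have hmap : P.map (fun ω (i : Fin N) => X i ω) = Measure.pi fun _ => coinMeasure t := by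
    have := hind.isProbabilityMeasure
    rw [(iIndepFun_iff_map_fun_eq_pi_map hm).1 hindN]
    congr 1
    ext1 i
    exact (hX i).map_eq
  have h1 : ∫ ω, f (fun i => X i ω) ∂P = ∫ σ, f σ ∂(Measure.pi fun _ => coinMeasure t) := by
    rw [← hmap, integral_map (aemeasurable_pi_lambda _ hm)
      (Measurable.of_discrete).aestronglyMeasurable]
  rw [h1, integral_fintype .of_finite]
  refine Finset.sum_congr rfl fun σ _ => ?_
  rw [smul_eq_mul, measureReal_def, Measure.pi_singleton]
  simp only [coinMeasure_singleton]
  rw [← ENNReal.ofReal_prod_of_nonneg fun i _ => coinWeight_nonneg ht _,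
    ENNReal.toReal_ofReal (Finset.prod_nonneg fun i _ => coinWeight_nonneg ht _)]

theorem exists_coins {t : ℝ} (ht : t ∈ Ioo (-1 : ℝ) 1) :
    ∃ (Ω : Type) (_ : MeasurableSpace Ω) (P : Measure Ω) (X : ℕ → Ω → ℤˣ),
      (∀ k, HasLaw (X k) (coinMeasure t) P) ∧ iIndepFun X P ∧ IsProbabilityMeasure P := by
  have := isProbabilityMeasure_coinMeasure ht
  obtain ⟨Ω, mΩ, P, X, -, h1, h2, h3⟩ := exists_iid ℕ (coinMeasure t)
  exact ⟨Ω, mΩ, P, X, h1, h2, h3⟩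

theorem integral_spin {t : ℝ} (ht : t ∈ Ioo (-1 : ℝ) 1) {Ω : Type*} [MeasurableSpace Ω]
    {P : Measure Ω} {X : Ω → ℤˣ} (hX : HasLaw X (coinMeasure t) P) :
    ∫ ω, ((X ω : ℤ) : ℝ) ∂P = t := by
  have h := integral_map hX.aemeasurable
    (Measurable.of_discrete (f := fun s : ℤˣ => ((s : ℤ) : ℝ))).aestronglyMeasurable
  rw [← h, hX.map_eq, integral_coinMeasure ht]
  simp [coinWeight]
  ring

theorem variance_spin {t : ℝ} (ht : t ∈ Ioo (-1 : ℝ) 1) {Ω : Type*} [MeasurableSpace Ω]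
    {P : Measure Ω} {X : Ω → ℤˣ} (hX : HasLaw X (coinMeasure t) P) :
    Var[fun ω => ((X ω : ℤ) : ℝ); P] = 1 - t ^ 2 := by
  have h := integral_map hX.aemeasurable
    (Measurable.of_discrete (f := fun s : ℤˣ => (((s : ℤ) : ℝ) - t) ^ 2)).aestronglyMeasurable
  have hm : AEMeasurable (fun ω => ((X ω : ℤ) : ℝ)) P :=
    (Measurable.of_discrete (f := fun s : ℤˣ => ((s : ℤ) : ℝ))).comp_aemeasurable hX.aemeasurable
  rw [variance_eq_integral hm, integral_spin ht hX, ← h, hX.map_eq, integral_coinMeasure ht]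
  simp [coinWeight]
  ring

theorem hasLaw_spin {t : ℝ} {Ω : Type*} [MeasurableSpace Ω] {P : Measure Ω} {X : Ω → ℤˣ}
    (hX : HasLaw X (coinMeasure t) P) :
    HasLaw (fun ω => ((X ω : ℤ) : ℝ)) ((coinMeasure t).map fun s : ℤˣ => ((s : ℤ) : ℝ)) P :=
  ⟨(Measurable.of_discrete (f := fun s : ℤˣ => ((s : ℤ) : ℝ))).comp_aemeasurable hX.aemeasurable, by
    rw [← hX.map_eq, AEMeasurable.map_map_of_aemeasurable Measurable.of_discrete.aemeasurable
      hX.aemeasurable]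
    rfl⟩

theorem memLp_spin {Ω : Type*} [MeasurableSpace Ω] {P : Measure Ω} [IsFiniteMeasure P]
    {X : Ω → ℤˣ} (hX : AEMeasurable X P) : MemLp (fun ω => ((X ω : ℤ) : ℝ)) 2 P := by
  refine MemLp.of_bound
    ((Measurable.of_discrete (f := fun s : ℤˣ => ((s : ℤ) : ℝ))).comp_aemeasurable
      hX).aestronglyMeasurable 1 (ae_of_all _ fun ω => ?_)
  rcases Int.units_eq_one_or (X ω) with h | h <;> simp [h]

/-- The central limit theorem for biased coins. -/
theorem tendsto_sum_coinWeight_mul {t : ℝ} (ht : t ∈ Ioo (-1 : ℝ) 1)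
    (g : BoundedContinuousFunction ℝ ℝ) :
    Tendsto (fun N : ℕ => ∑ σ : Hypercube N,
      (∏ i, coinWeight t (σ i)) * g ((√N)⁻¹ * (spinSum σ - N * t))) atTop
      (𝓝 (∫ x, g x ∂(gaussianReal 0 (1 - t ^ 2).toNNReal))) := by
  obtain ⟨Ω, mΩ, P, X, hX, hind, hP⟩ := exists_coins ht
  have hclt := tendstoInDistribution_inv_sqrt_mul_sum_sub
    (X := fun k ω => ((X k ω : ℤ) : ℝ)) (P := P) (Y := id)
    (P' := gaussianReal 0 (Var[fun ω => ((X 0 ω : ℤ) : ℝ); P]).toNNReal) HasLaw.id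
    (memLp_spin (hX 0).aemeasurable)
    (hind.comp (fun _ s => ((s : ℤ) : ℝ)) fun _ => Measurable.of_discrete)
    fun k => ⟨(hasLaw_spin (hX k)).aemeasurable, (hasLaw_spin (hX 0)).aemeasurable, by
      rw [(hasLaw_spin (hX k)).map_eq, (hasLaw_spin (hX 0)).map_eq]⟩
  have := (tendstoInDistribution_iff_integral hclt.forall_aemeasurable
    hclt.aemeasurable_limit).1 hclt g
  rw [variance_spin ht (hX 0), integral_spin ht (hX 0)] at this
  refine this.congr fun N => ?_
  rw [← integral_coins ht hX hind N fun σ => g ((√N)⁻¹ * (spinSum σ - N * t))]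
  simp only [spinSum, Finset.sum_range]

theorem sum_prod_coinWeight {t : ℝ} (ht : t ∈ Ioo (-1 : ℝ) 1) (N : ℕ) :
    ∑ σ : Hypercube N, ∏ i, coinWeight t (σ i) = 1 := by
  obtain ⟨Ω, mΩ, P, X, hX, hind, hP⟩ := exists_coins ht
  simpa using (integral_coins ht hX hind N fun _ => 1).symm

theorem sum_prod_coinWeight_mul_sq {t : ℝ} (ht : t ∈ Ioo (-1 : ℝ) 1) (N : ℕ) :
    ∑ σ : Hypercube N, (∏ i, coinWeight t (σ i)) * (spinSum σ - N * t) ^ 2 = N * (1 - t ^ 2) := by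
  obtain ⟨Ω, mΩ, P, X, hX, hind, hP⟩ := exists_coins ht
  have hL := fun k => memLp_spin (hX k).aemeasurable
  have hs : Var[∑ k ∈ Finset.range N, fun ω => ((X k ω : ℤ) : ℝ); P] = N * (1 - t ^ 2) := by
    rw [IndepFun.variance_sum (fun k _ => hL k) fun i _ j _ hij =>
      (hind.indepFun hij).comp (φ := fun s : ℤˣ => ((s : ℤ) : ℝ))
        (ψ := fun s : ℤˣ => ((s : ℤ) : ℝ))
        Measurable.of_discrete Measurable.of_discrete]
    simp [fun k => variance_spin ht (hX k)]
    ring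
  have hE : ∫ ω, (∑ k ∈ Finset.range N, fun ω => ((X k ω : ℤ) : ℝ)) ω ∂P = N * t := by
    simp_rw [Finset.sum_apply]
    rw [integral_finsetSum _ fun k _ => (hL k).integrable one_le_two]
    simp [fun k => integral_spin ht (hX k)]
  rw [← hs, variance_eq_integral (Finset.aemeasurable_sum _ fun k _ => (hL k).aemeasurable), hE,
    ← integral_coins ht hX hind N fun σ => (spinSum σ - N * t) ^ 2]
  simp only [spinSum, Finset.sum_range, Finset.sum_apply]

/-- From `|W| ≤ 1/2 + W²/2` and the second moment `1 - t² ≤ 1`. It controls the errors linear in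
`W`, uniformly in `N`. -/
theorem sum_prod_coinWeight_mul_abs_le {t : ℝ} (ht : t ∈ Ioo (-1 : ℝ) 1) {N : ℕ} (hN : 0 < N) :
    ∑ σ : Hypercube N, (∏ i, coinWeight t (σ i)) * |(√N)⁻¹ * (spinSum σ - N * t)| ≤ 1 := by
  have hN' : (0 : ℝ) < N := by exact_mod_cast hN
  have h1 := sum_prod_coinWeight ht N
  have h2 := sum_prod_coinWeight_mul_sq ht N
  have hle : ∀ σ : Hypercube N, (∏ i, coinWeight t (σ i)) * |(√N)⁻¹ * (spinSum σ - N * t)| ≤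
      (∏ i, coinWeight t (σ i)) / 2 +
      (∏ i, coinWeight t (σ i)) * (spinSum σ - N * t) ^ 2 * (1 / (2 * N)) := by
    intro σ
    have hw : 0 ≤ ∏ i, coinWeight t (σ i) := Finset.prod_nonneg fun i _ => coinWeight_nonneg ht _
    have hsq : |(√N)⁻¹ * (spinSum σ - N * t)| ^ 2 = (spinSum σ - N * t) ^ 2 / N := by
      rw [sq_abs, mul_pow, inv_pow, Real.sq_sqrt hN'.le]
      ring
    have hab : |(√N)⁻¹ * (spinSum σ - N * t)| ≤
        1 / 2 + (spinSum σ - N * t) ^ 2 * (1 / (2 * N)) := by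
      have e : (spinSum σ - N * t) ^ 2 * (1 / (2 * N)) = (spinSum σ - N * t) ^ 2 / N / 2 := by
        field_simp
      rw [e, ← hsq]
      nlinarith [sq_nonneg (|(√N)⁻¹ * (spinSum σ - N * t)| - 1)]
    nlinarith [mul_le_mul_of_nonneg_left hab hw]
  refine (Finset.sum_le_sum fun σ _ => hle σ).trans ?_
  rw [Finset.sum_add_distrib, ← Finset.sum_div, ← Finset.sum_mul, h1, h2]
  have : N * (1 - t ^ 2) * (1 / (2 * (N : ℝ))) = (1 - t ^ 2) / 2 := by field_simp
  rw [this]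
  nlinarith [sq_nonneg t]

/-! ### Asymptotics of the scaling -/

theorem scaleA_pos {h : ℝ} (hh : 0 ≤ h) {N : ℕ} (hN : 0 < N) : 0 < scaleA N h := by
  have := rhoFun_pos (tStar_mem_Ioo hh)
  have : (0 : ℝ) < N := by exact_mod_cast hN
  unfold scaleA
  positivity

theorem tendsto_sqrt_natCast : Tendsto (fun N : ℕ => √(N : ℝ)) atTop atTop :=
  Real.tendsto_sqrt_atTop.comp tendsto_natCast_atTop_atTop

theorem tendsto_scaleA {h : ℝ} (hh : 0 ≤ h) : Tendsto (fun N => scaleA N h) atTop (𝓝 0) :=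
  (tendsto_sqrt_natCast.const_mul_atTop (rhoFun_pos (tStar_mem_Ioo hh))).inv_tendsto_atTop

/-- The constant `(1 - t_*²) (I''(t_*) + h²)`. -/
noncomputable def curvature (h : ℝ) : ℝ := 1 + h ^ 2 * (1 - tStar h ^ 2)

theorem one_sub_sq_pos {t : ℝ} (ht : t ∈ Ioo (-1 : ℝ) 1) : 0 < 1 - t ^ 2 := by
  nlinarith [ht.1, ht.2]

theorem curvature_pos {h : ℝ} (hh : 0 ≤ h) : 0 < curvature h := by
  have := one_sub_sq_pos (tStar_mem_Ioo hh)
  unfold curvature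
  positivity

/-- The deviation of the level `u_{N,h}(x)` from its leading term. -/
noncomputable def levelShift (N : ℕ) (h x : ℝ) : ℝ := remScaling N h x - maxEnergy h * √N

theorem levelShift_eq {h : ℝ} (hh : 0 ≤ h) (N : ℕ) (x : ℝ) : levelShift N h x =
    scaleA N h * (x + Real.log (scaleA N h ^ 2 / (2 * Real.pi * curvature h)) / 2) := by
  have hv := one_sub_sq_pos (tStar_mem_Ioo hh)
  have e : 2 * Real.pi * (1 - tStar h ^ 2) * (iteratedDeriv 2 cramerEntropy (tStar h) + h ^ 2) =
      2 * Real.pi * curvature h := by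
    rw [iteratedDeriv_two_cramerEntropy (tStar_mem_Ioo hh), curvature]
    field_simp
  rw [levelShift, remScaling, scaleB, e]
  ring

/-- The logarithmic correction is harmless at leading order because `A log A → 0` as `A → 0`. -/
theorem tendsto_levelShift {h : ℝ} (hh : 0 ≤ h) (x : ℝ) :
    Tendsto (fun N => levelShift N h x) atTop (𝓝 0) := by
  have hA := tendsto_scaleA hh
  have hq := curvature_pos hh
  have hlog : Tendsto (fun N => scaleA N h * Real.log (scaleA N h)) atTop (𝓝 0) := by
    have := (Real.continuous_mul_log.tendsto 0).comp hA
    rwa [zero_mul] at this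
  have : Tendsto (fun N => scaleA N h * (x - Real.log (2 * Real.pi * curvature h) / 2) +
      scaleA N h * Real.log (scaleA N h)) atTop (𝓝 0) := by
    simpa using (hA.mul_const (x - Real.log (2 * Real.pi * curvature h) / 2)).add hlog
  refine this.congr' ?_
  filter_upwards [eventually_gt_atTop 0] with N hN
  have hApos := scaleA_pos hh hN
  rw [levelShift_eq hh, Real.log_div (by positivity) (by positivity), Real.log_pow]
  push_cast
  ring

/-- This is what the logarithm in `B_N` is for: `√(2π) ρ√N` cancels the denominator of the Gaussian
tail, and `√(curvature h)` cancels the constant from the central limit theorem. -/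
theorem exp_neg_mul_levelShift {h : ℝ} (hh : 0 ≤ h) {N : ℕ} (hN : 0 < N) (x : ℝ) :
    Real.exp (-(rhoFun (tStar h) * √N * levelShift N h x)) =
      Real.exp (-x) * (√(2 * Real.pi) * √(curvature h) * (rhoFun (tStar h) * √N)) := by
  have hq := curvature_pos hh
  have hA := scaleA_pos hh hN
  have hz : 0 < scaleA N h ^ 2 / (2 * Real.pi * curvature h) := by positivity
  have e1 : rhoFun (tStar h) * √N = (scaleA N h)⁻¹ := by rw [scaleA, inv_inv]
  rw [e1, levelShift_eq hh, inv_mul_cancel_left₀ hA.ne', neg_add, Real.exp_add,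
    ← Real.log_sqrt hz.le, Real.exp_neg (Real.log _), Real.exp_log (Real.sqrt_pos.2 hz),
    Real.sqrt_div (by positivity), Real.sqrt_sq hA.le, Real.sqrt_mul (by positivity)]
  congr 1
  field_simp

theorem spinSum_le {N : ℕ} (σ : Hypercube N) : spinSum σ ≤ N := by
  have : spinSum σ ≤ ∑ _i : Fin N, (1 : ℝ) := Finset.sum_le_sum fun i _ => by
    rcases Int.units_eq_one_or (σ i) with h | h <;> simp [h]
  simpa using this

/-- The worst case is a total spin of `N`, where the level is `(M - h)√N` plus a vanishing shift;
half of the margin absorbs the shift. -/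
theorem eventually_le_remScaling_sub {h : ℝ} (hh : 0 ≤ h) (x : ℝ) :
    ∀ᶠ N in atTop, ∀ σ : Hypercube N,
      (maxEnergy h - h) / 2 * √N ≤ remScaling N h x - h / √N * spinSum σ := by
  have hc : 0 < (maxEnergy h - h) / 2 := by linarith [lt_maxEnergy h]
  have h1 := (tendsto_levelShift hh x).eventually (Metric.ball_mem_nhds 0 hc)
  filter_upwards [h1, eventually_gt_atTop 0] with N hN hN0 σ
  have hN1 : (1 : ℝ) ≤ √N := Real.one_le_sqrt.2 (by exact_mod_cast hN0)
  have hN' : (0 : ℝ) < N := by exact_mod_cast hN0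
  rw [Real.dist_0_eq_abs, abs_lt, levelShift] at hN
  have h2 : h / √N * spinSum σ ≤ h * √N := by
    refine (mul_le_mul_of_nonneg_left (spinSum_le σ) (by positivity)).trans_eq ?_
    rw [div_mul_eq_mul_div, mul_div_assoc, Real.div_sqrt]
  nlinarith [hN.1]

/-! ### Exponential tilting and the expected number of points -/

theorem prod_coinWeight_tStar {h : ℝ} (hh : 0 ≤ h) {N : ℕ} (σ : Hypercube N) :
    ∏ i, coinWeight (tStar h) (σ i) = Real.exp (-N * rhoFun (tStar h) ^ 2 / 2 +
      h * rhoFun (tStar h) * (spinSum σ - N * tStar h)) := by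
  have h1 : ∀ s : ℤˣ, coinWeight (tStar h) s = Real.exp (-rhoFun (tStar h) ^ 2 / 2 +
      h * rhoFun (tStar h) * (((s : ℤ) : ℝ) - tStar h)) := by
    intro s
    rcases Int.units_eq_one_or s with rfl | rfl
    · simpa [coinWeight] using half_one_add_tStar hh
    · simpa [coinWeight, sub_eq_add_neg] using half_one_sub_tStar hh
  simp_rw [h1]
  rw [← Real.exp_sum, Finset.sum_add_distrib, ← Finset.mul_sum, Finset.sum_sub_distrib, spinSum]
  congr 1
  simp
  ring

/-- As `M = ρ + h t_*`, the term `h t_* √N` exactly centres the magnetization. -/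
theorem remScaling_sub_eq {h : ℝ} {N : ℕ} (hN : 0 < N) (x : ℝ) (σ : Hypercube N) :
    remScaling N h x - h / √N * spinSum σ = rhoFun (tStar h) * √N +
      (levelShift N h x - h * ((√N)⁻¹ * (spinSum σ - N * tStar h))) := by
  have hN' : (0 : ℝ) < N := by exact_mod_cast hN
  have e : (√N)⁻¹ * N = √(N : ℝ) := by
    rw [inv_mul_eq_div, Real.div_sqrt]
  rw [levelShift, maxEnergy_eq]
  linear_combination -(h * tStar h) * e

/-- The Gaussian tail at the level of a configuration, in terms of the tilted weights. -/
theorem gaussianTail_remScaling_sub {h : ℝ} (hh : 0 ≤ h) {N : ℕ} (hN : 0 < N) (x : ℝ)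
    (σ : Hypercube N) (hy : 0 < remScaling N h x - h / √N * spinSum σ) :
    gaussianTail (remScaling N h x - h / √N * spinSum σ) =
      Real.exp (-x) * √(curvature h) * ((∏ i, coinWeight (tStar h) (σ i)) *
        (millsRatio (remScaling N h x - h / √N * spinSum σ) *
          (rhoFun (tStar h) * √N / (remScaling N h x - h / √N * spinSum σ)) *
          Real.exp (-(levelShift N h x - h * ((√N)⁻¹ * (spinSum σ - N * tStar h))) ^ 2 / 2))) := by
  have hN' : (0 : ℝ) < N := by exact_mod_cast hN
  have hsq : √(N : ℝ) ^ 2 = N := Real.sq_sqrt hN'.le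
  have e1 : √(N : ℝ) * (√N)⁻¹ = 1 := mul_inv_cancel₀ (by positivity)
  rw [gaussianTail_eq_millsRatio hy]
  set y := remScaling N h x - h / √N * spinSum σ with hydef
  -- Expanding the square, `-Nρ²/2` and the cross term in `W` form the coin weight; the cross term
  -- in the shift and the remaining square give the other two factors.
  have hE : Real.exp (-y ^ 2 / 2) = (∏ i, coinWeight (tStar h) (σ i)) *
      Real.exp (-(rhoFun (tStar h) * √N * levelShift N h x)) *
      Real.exp (-(levelShift N h x - h * ((√N)⁻¹ * (spinSum σ - N * tStar h))) ^ 2 / 2) := by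
    rw [prod_coinWeight_tStar hh, ← Real.exp_add, ← Real.exp_add, hydef, remScaling_sub_eq hN]
    congr 1
    linear_combination (-rhoFun (tStar h) ^ 2 / 2) * hsq +
      (h * rhoFun (tStar h) * (spinSum σ - N * tStar h)) * e1
  rw [hE, exp_neg_mul_levelShift hh hN]
  have := Real.sqrt_pos.2 (by positivity : 0 < 2 * Real.pi)
  field_simp

/-- The three errors come from the Mills ratio, from replacing `y` by `r * s` in the denominator,
and from dropping `d` in the exponent. In the application `s = √N`, `r = ρ(t_*)`, `w = W` and `d` is
the level shift. -/
theorem abs_millsRatio_mul_sub_le {h : ℝ} (hh : 0 ≤ h) {y c s r w d : ℝ} (hr : 0 < r) (hc : 0 < c)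
    (hs : 0 < s) (hcy : c * s ≤ y) (hy : y = r * s + (d - h * w)) :
    |millsRatio y * (r * s / y) * Real.exp (-(d - h * w) ^ 2 / 2) - Real.exp (-(h * w) ^ 2 / 2)| ≤
      r / (c ^ 3 * s ^ 2) + (h * |w| + |d|) / (c * s) + |d| := by
  have hcs : 0 < c * s := by positivity
  have hy0 : 0 < y := hcs.trans_le hcy
  have hm := abs_millsRatio_sub_one_le hy0
  have h1 : |(millsRatio y - 1) * (r * s / y)| ≤ r / (c ^ 3 * s ^ 2) := by
    rw [abs_mul, abs_of_pos (by positivity : 0 < r * s / y)]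
    calc |millsRatio y - 1| * (r * s / y) ≤ 1 / (c * s) ^ 2 * (r * s / (c * s)) := by
          gcongr
          exact hm.trans (by gcongr)
      _ = r / (c ^ 3 * s ^ 2) := by
          field_simp
  have h2 : |r * s / y - 1| ≤ (h * |w| + |d|) / (c * s) := by
    rw [div_sub_one hy0.ne', abs_div, abs_of_pos hy0]
    have : |r * s - y| ≤ h * |w| + |d| := by
      rw [hy, show r * s - (r * s + (d - h * w)) = h * w - d by ring]
      refine (abs_sub _ _).trans_eq ?_
      rw [abs_mul, abs_of_nonneg hh]
    gcongr
  have h3 : |Real.exp (-(d - h * w) ^ 2 / 2) - Real.exp (-(h * w) ^ 2 / 2)| ≤ |d| := by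
    have := abs_exp_neg_sq_sub_le (d - h * w) (-(h * w))
    rwa [neg_sq (h * w), show d - h * w - -(h * w) = d by ring] at this
  have h4 : |Real.exp (-(d - h * w) ^ 2 / 2)| ≤ 1 := by
    rw [abs_of_pos (Real.exp_pos _), Real.exp_le_one_iff]
    nlinarith [sq_nonneg (d - h * w)]
  have e : millsRatio y * (r * s / y) * Real.exp (-(d - h * w) ^ 2 / 2) -
      Real.exp (-(h * w) ^ 2 / 2) =
      ((millsRatio y - 1) * (r * s / y) + (r * s / y - 1)) * Real.exp (-(d - h * w) ^ 2 / 2) +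
      (Real.exp (-(d - h * w) ^ 2 / 2) - Real.exp (-(h * w) ^ 2 / 2)) := by ring
  rw [e]
  refine (abs_add_le _ _).trans (add_le_add ?_ h3)
  rw [abs_mul]
  refine (mul_le_of_le_one_right (abs_nonneg _) h4).trans ?_
  exact (abs_add_le _ _).trans (add_le_add h1 h2)

/-- The expected number of points above the level `x` converges to `exp (-x)`. -/
theorem tendsto_sum_gaussianTail {h : ℝ} (hh : 0 ≤ h) (x : ℝ) :
    Tendsto (fun N => ∑ σ : Hypercube N, gaussianTail (remScaling N h x - h / √N * spinSum σ))
      atTop (𝓝 (Real.exp (-x))) := by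
  have ht := tStar_mem_Ioo hh
  have hr := rhoFun_pos ht
  have hq := curvature_pos hh
  set c : ℝ := (maxEnergy h - h) / 2 with hcdef
  have hc : 0 < c := by
    rw [hcdef]
    linarith [lt_maxEnergy h]
  let W : (N : ℕ) → Hypercube N → ℝ := fun N σ => (√N)⁻¹ * (spinSum σ - N * tStar h)
  let w : (N : ℕ) → Hypercube N → ℝ := fun N σ => ∏ i, coinWeight (tStar h) (σ i)
  let G : (N : ℕ) → Hypercube N → ℝ := fun N σ =>
    millsRatio (remScaling N h x - h / √N * spinSum σ) *
      (rhoFun (tStar h) * √N / (remScaling N h x - h / √N * spinSum σ)) *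
      Real.exp (-(levelShift N h x - h * W N σ) ^ 2 / 2)
  have hw : ∀ N σ, 0 ≤ w N σ := fun N σ => Finset.prod_nonneg fun i _ => coinWeight_nonneg ht _
  let g : BoundedContinuousFunction ℝ ℝ := BoundedContinuousFunction.ofNormedAddCommGroup
    (fun y => Real.exp (-(h * y) ^ 2 / 2)) (by fun_prop) 1 fun y => by
      rw [Real.norm_of_nonneg (Real.exp_pos _).le, Real.exp_le_one_iff]
      nlinarith [sq_nonneg (h * y)]
  have hclt : Tendsto (fun N => ∑ σ, w N σ * Real.exp (-(h * W N σ) ^ 2 / 2)) atTop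
      (𝓝 (√(curvature h))⁻¹) := by
    have := tendsto_sum_coinWeight_mul ht g
    have e : ∫ y, g y ∂(gaussianReal 0 (1 - tStar h ^ 2).toNNReal) = (√(curvature h))⁻¹ :=
      integral_exp_neg_sq_gaussianReal h (one_sub_sq_pos ht)
    rw [e] at this
    exact this
  have hs := tendsto_sqrt_natCast
  have hδ := tendsto_levelShift hh x
  have herr : Tendsto (fun N => ∑ σ, w N σ * G N σ -
      ∑ σ, w N σ * Real.exp (-(h * W N σ) ^ 2 / 2)) atTop (𝓝 0) := by
    have hlim : Tendsto (fun N : ℕ => rhoFun (tStar h) / (c ^ 3 * √N ^ 2) +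
        (h * 1 + |levelShift N h x|) / (c * √N) + |levelShift N h x|) atTop (𝓝 0) := by
      have h1 : Tendsto (fun N : ℕ => rhoFun (tStar h) / (c ^ 3 * √N ^ 2)) atTop (𝓝 0) :=
        tendsto_const_nhds.div_atTop
          (((tendsto_pow_atTop two_ne_zero).comp hs).const_mul_atTop (by positivity))
      have h2 : Tendsto (fun N : ℕ => (h * 1 + |levelShift N h x|) / (c * √N)) atTop (𝓝 0) :=
        (tendsto_const_nhds.add hδ.abs).div_atTop (hs.const_mul_atTop hc)
      simpa using (h1.add h2).add hδ.abs
    refine squeeze_zero_norm' ?_ hlim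
    filter_upwards [eventually_le_remScaling_sub hh x, eventually_gt_atTop 0] with N hN hN0
    have hN' : (0 : ℝ) < √N := Real.sqrt_pos.2 (by exact_mod_cast hN0)
    rw [← Finset.sum_sub_distrib]
    -- The pointwise error is affine in `|W|`, so its tilted average needs only total mass `1` and
    -- first absolute moment at most `1`.
    calc ‖∑ σ, (w N σ * G N σ - w N σ * Real.exp (-(h * W N σ) ^ 2 / 2))‖
        ≤ ∑ σ, w N σ * (rhoFun (tStar h) / (c ^ 3 * √N ^ 2) +
            (h * |W N σ| + |levelShift N h x|) / (c * √N) + |levelShift N h x|) := by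
          refine norm_sum_le_of_le _ fun σ _ => ?_
          rw [← mul_sub, norm_mul, Real.norm_of_nonneg (hw N σ), Real.norm_eq_abs]
          exact mul_le_mul_of_nonneg_left (abs_millsRatio_mul_sub_le hh hr hc hN' (hN σ)
            (remScaling_sub_eq hN0 x σ)) (hw N σ)
      _ = (∑ σ, w N σ) * (rhoFun (tStar h) / (c ^ 3 * √N ^ 2) +
            |levelShift N h x| / (c * √N) + |levelShift N h x|) +
            (∑ σ, w N σ * |W N σ|) * (h / (c * √N)) := by
          rw [Finset.sum_mul, Finset.sum_mul, ← Finset.sum_add_distrib]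
          refine Finset.sum_congr rfl fun σ _ => ?_
          ring
      _ ≤ 1 * (rhoFun (tStar h) / (c ^ 3 * √N ^ 2) +
            |levelShift N h x| / (c * √N) + |levelShift N h x|) + 1 * (h / (c * √N)) := by
          gcongr
          · exact (sum_prod_coinWeight ht N).le
          · exact sum_prod_coinWeight_mul_abs_le ht hN0
      _ = _ := by ring
  have hmain := (herr.add hclt).const_mul (Real.exp (-x) * √(curvature h))
  have hlimit : Real.exp (-x) * √(curvature h) * (0 + (√(curvature h))⁻¹) = Real.exp (-x) := by
    have := Real.sqrt_pos.2 hq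
    field_simp
    ring
  rw [hlimit] at hmain
  refine hmain.congr' ?_
  filter_upwards [eventually_le_remScaling_sub hh x, eventually_gt_atTop 0] with N hN hN0
  have hN' : (0 : ℝ) < √N := Real.sqrt_pos.2 (by exact_mod_cast hN0)
  rw [sub_add_cancel, Finset.mul_sum]
  refine Finset.sum_congr rfl fun σ _ => ?_
  exact (gaussianTail_remScaling_sub hh hN0 x σ ((by positivity : 0 < c * √N).trans_le (hN σ))).symm

/-! ### The random energy model consists of independent standard Gaussians -/

theorem lexOverlap_lt_one {N : ℕ} {σ τ : Hypercube N} (h : σ ≠ τ) : lexOverlap σ τ < 1 := by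
  have hN : (0 : ℝ) < N := by
    rcases Nat.eq_zero_or_pos N with rfl | hN
    · exact absurd (Subsingleton.elim σ τ) h
    · exact_mod_cast hN
  rw [lexOverlap, div_lt_one hN, Nat.cast_lt]
  refine lt_of_le_of_ne (Nat.findGreatest_le N) fun he => h ?_
  have := Nat.findGreatest_spec (P := fun k => ∀ i : Fin N, (i : ℕ) < k → σ i = τ i)
    (Nat.zero_le N) (by simp)
  rw [he] at this
  exact funext fun i => this i i.2

theorem lexOverlap_self {N : ℕ} (hN : 0 < N) (σ : Hypercube N) : lexOverlap σ σ = 1 := by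
  have hN' : (N : ℝ) ≠ 0 := by exact_mod_cast hN.ne'
  rw [lexOverlap, Nat.findGreatest_eq (P := fun k => ∀ i : Fin N, (i : ℕ) < k → σ i = σ i)
    fun _ _ => rfl, div_self hN']

namespace IsREM

variable {Ω : Type*} [MeasurableSpace Ω] {P : Measure Ω} {N : ℕ} {Y : Hypercube N → Ω → ℝ}

theorem aemeasurable (hY : IsREM P N Y) (σ : Hypercube N) : AEMeasurable (Y σ) P :=
  hY.gaussian.aemeasurable σ

theorem covariance_eq (hY : IsREM P N Y) (σ τ : Hypercube N) :
    cov[Y σ, Y τ; P] = remOrderParameter (lexOverlap σ τ) := by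
  rw [← hY.covariance, ProbabilityTheory.covariance]
  simp [hY.centred]

/-- Distinct configurations have overlap below the jump, and uncorrelated jointly Gaussian variables
are independent. The `Unit` index fits the family to the criterion for independent blocks. -/
theorem iIndepFun (hY : IsREM P N Y) : iIndepFun Y P := by
  have hg : IsGaussianProcess (fun (p : (_ : Hypercube N) × Unit) ω => Y p.1 ω) P :=
    hY.gaussian.comp_right Sigma.fst
  have h := hg.iIndepFun_of_covariance_eq_zero (X := fun σ _ => Y σ)
    (fun σ _ => hY.aemeasurable σ) fun σ τ hne _ _ => by
      rw [hY.covariance_eq, remOrderParameter, if_neg (lexOverlap_lt_one hne).not_ge]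
  exact h.comp (fun _ f => f ()) fun _ => measurable_pi_apply ()

/-- For `N = 0` the self-overlap is `0 / 0 = 0`, so the variance would be `0`; hence `0 < N`. -/
theorem map_eq (hY : IsREM P N Y) (hN : 0 < N) (σ : Hypercube N) :
    P.map (Y σ) = gaussianReal 0 1 := by
  have hv : Var[Y σ; P] = 1 := by
    rw [← covariance_self (hY.aemeasurable σ), hY.covariance_eq, lexOverlap_self hN,
      remOrderParameter, if_pos le_rfl]
  rw [(hY.gaussian.hasGaussianLaw_eval σ).map_eq_gaussianReal, hv, hY.centred]
  simp

end IsREM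

/-! ### The points of the energy process -/

/-- The rescaled energy of a configuration. -/
noncomputable def energyPoint {Ω : Type*} {N : ℕ} (Y : Hypercube N → Ω → ℝ) (h : ℝ)
    (σ : Hypercube N) (ω : Ω) : ℝ :=
  remScalingInv N h (withField Y h σ ω)

theorem measurable_energyPoint_map (N : ℕ) (h : ℝ) (σ : Hypercube N) :
    Measurable fun y : ℝ => remScalingInv N h (y + h / √N * spinSum σ) := by
  unfold remScalingInv
  fun_prop

theorem real_toMeasure_energyProcess {Ω : Type*} {N : ℕ} (Y : Hypercube N → Ω → ℝ) (h : ℝ)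
    (ω : Ω) {B : Set ℝ} (hB : MeasurableSet B) :
    (energyProcess Y h ω).toMeasure.real B =
      ∑ σ, B.indicator (fun _ => (1 : ℝ)) (energyPoint Y h σ ω) := by
  rw [energyProcess, measureReal_def, Measure.finsetSum_apply,
    ENNReal.toReal_sum fun σ _ => measure_ne_top _ _]
  refine Finset.sum_congr rfl fun σ _ => ?_
  rw [Measure.dirac_apply' _ hB, energyPoint]
  by_cases hx : remScalingInv N h (withField Y h σ ω) ∈ B <;> simp [hx]

/-- Yields measurability of the point process for the vague Borel `σ`-algebra from measurability of
the finitely many points. -/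
theorem continuous_sum_dirac (ι : Type*) [Fintype ι] :
    Continuous fun x : ι → ℝ =>
      (⟨∑ i, Measure.dirac (x i), inferInstance⟩ : LocFinMeasure) := by
  rw [LocFinMeasure.continuous_iff_integral]
  intro φ
  have : ∀ x : ι → ℝ, ∫ y, φ y ∂(∑ i, Measure.dirac (x i)) = ∑ i, φ (x i) := by
    intro x
    rw [integral_finsetSum_measure fun i _ =>
      LocFinMeasure.integrable_compactlySupported ⟨Measure.dirac (x i), inferInstance⟩ φ]
    simp
  simp only [this]
  fun_prop

section EnergyPoint

variable {Ω : Type*} [MeasurableSpace Ω] {P : Measure Ω} {N : ℕ} {Y : Hypercube N → Ω → ℝ}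

theorem aemeasurable_energyPoint (hY : IsREM P N Y) (h : ℝ) (σ : Hypercube N) :
    AEMeasurable (energyPoint Y h σ) P :=
  (measurable_energyPoint_map N h σ).comp_aemeasurable (hY.aemeasurable σ)

theorem iIndepFun_energyPoint (hY : IsREM P N Y) (h : ℝ) : iIndepFun (energyPoint Y h) P :=
  hY.iIndepFun.comp _ fun σ => measurable_energyPoint_map N h σ

theorem measureReal_map_energyPoint_Ici (hY : IsREM P N Y) {h : ℝ} (hh : 0 ≤ h) (hN : 0 < N)
    (σ : Hypercube N) (x : ℝ) : (P.map (energyPoint Y h σ)).real (Ici x) =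
      gaussianTail (remScaling N h x - h / √N * spinSum σ) := by
  have hA := scaleA_pos hh hN
  have hm := measurable_energyPoint_map N h σ
  have e : P.map (energyPoint Y h σ) =
      (P.map (Y σ)).map fun y : ℝ => remScalingInv N h (y + h / √N * spinSum σ) := by
    rw [AEMeasurable.map_map_of_aemeasurable hm.aemeasurable (hY.aemeasurable σ)]
    rfl
  rw [e, hY.map_eq hN, map_measureReal_apply hm measurableSet_Ici, gaussianTail]
  congr 1
  ext y
  rw [mem_preimage, mem_Ici, mem_Ici, remScalingInv, le_div_iff₀ hA, remScaling]
  constructor <;> intro <;> linarith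

theorem measureReal_map_energyPoint_Ico [IsProbabilityMeasure P] (hY : IsREM P N Y) {h : ℝ}
    (hh : 0 ≤ h) (hN : 0 < N) (σ : Hypercube N) {a b : ℝ} (hab : a ≤ b) :
    (P.map (energyPoint Y h σ)).real (Ico a b) =
      gaussianTail (remScaling N h a - h / √N * spinSum σ) -
      gaussianTail (remScaling N h b - h / √N * spinSum σ) := by
  have := Measure.isProbabilityMeasure_map (aemeasurable_energyPoint hY h σ)
  rw [← measureReal_map_energyPoint_Ici hY hh hN, ← measureReal_map_energyPoint_Ici hY hh hN,
    ← measureReal_sdiff (Ici_subset_Ici.2 hab) measurableSet_Ici, Ici_sdiff_Ici]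

theorem aemeasurable_energyProcess (hY : IsREM P N Y) (h : ℝ) :
    AEMeasurable (energyProcess Y h) P :=
  (continuous_sum_dirac (Hypercube N)).measurable.comp_aemeasurable
    (aemeasurable_pi_lambda _ fun σ => aemeasurable_energyPoint hY h σ)

theorem integral_real_toMeasure_energyProcess [IsProbabilityMeasure P] (hY : IsREM P N Y) (h : ℝ)
    {B : Set ℝ} (hB : MeasurableSet B) :
    Integrable (fun ω => (energyProcess Y h ω).toMeasure.real B) P ∧
    ∫ ω, (energyProcess Y h ω).toMeasure.real B ∂P =
      ∑ σ, (P.map (energyPoint Y h σ)).real B := by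
  have hm : Measurable (B.indicator fun _ : ℝ => (1 : ℝ)) := measurable_const.indicator hB
  have hint : ∀ σ, Integrable (fun ω => B.indicator (fun _ => (1 : ℝ)) (energyPoint Y h σ ω)) P :=
    fun σ => .of_bound (hm.comp_aemeasurable (aemeasurable_energyPoint hY h σ)).aestronglyMeasurable
      1 (ae_of_all _ fun ω => by
        refine (norm_indicator_le_norm_self _ _).trans ?_
        simp)
  simp_rw [real_toMeasure_energyProcess Y h _ hB]
  refine ⟨integrable_finsetSum _ fun σ _ => hint σ, ?_⟩
  rw [integral_finsetSum _ fun σ _ => hint σ]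
  refine Finset.sum_congr rfl fun σ _ => ?_
  rw [← integral_map (aemeasurable_energyPoint hY h σ) hm.aestronglyMeasurable,
    integral_indicator_const _ hB, smul_eq_mul, mul_one]

end EnergyPoint

/-! ### Mean counts, uniform smallness and tightness -/

section Limits

variable {Ω : ℕ → Type*} [∀ N, MeasurableSpace (Ω N)] {P : (N : ℕ) → Measure (Ω N)}
  [∀ N, IsProbabilityMeasure (P N)] {Y : (N : ℕ) → Hypercube N → Ω N → ℝ}

theorem tendsto_sum_measureReal_map_energyPoint (hY : ∀ N, IsREM (P N) N (Y N)) {h : ℝ}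
    (hh : 0 ≤ h) {a b : ℝ} (hab : a ≤ b) :
    Tendsto (fun N => ∑ σ, ((P N).map (energyPoint (Y N) h σ)).real (Ico a b)) atTop
      (𝓝 (Real.exp (-a) - Real.exp (-b))) := by
  refine ((tendsto_sum_gaussianTail hh a).sub (tendsto_sum_gaussianTail hh b)).congr' ?_
  filter_upwards [eventually_gt_atTop 0] with N hN
  rw [← Finset.sum_sub_distrib]
  exact Finset.sum_congr rfl fun σ _ =>
    (measureReal_map_energyPoint_Ico (hY N) hh hN σ hab).symm

theorem eventually_measureReal_map_energyPoint_le (hY : ∀ N, IsREM (P N) N (Y N)) {h : ℝ}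
    (hh : 0 ≤ h) {a b : ℝ} (hab : a ≤ b) :
    ∀ᶠ N in atTop, ∀ σ, ((P N).map (energyPoint (Y N) h σ)).real (Ico a b) ≤
      gaussianTail ((maxEnergy h - h) / 2 * √N) := by
  filter_upwards [eventually_le_remScaling_sub hh a, eventually_gt_atTop 0] with N hN hN0 σ
  rw [measureReal_map_energyPoint_Ico (hY N) hh hN0 σ hab]
  have := gaussianTail_anti (hN σ)
  linarith [gaussianTail_nonneg (remScaling N h b - h / √N * spinSum σ)]

theorem tendsto_gaussianTail_mul_sqrt (h : ℝ) :
    Tendsto (fun N : ℕ => gaussianTail ((maxEnergy h - h) / 2 * √N)) atTop (𝓝 0) :=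
  tendsto_gaussianTail_atTop.comp
    (tendsto_sqrt_natCast.const_mul_atTop (by linarith [lt_maxEnergy h]))

/-- Markov's inequality: the mean counts converge, hence are bounded over all `N`. -/
theorem exists_measureReal_energyProcess_gt_le (hY : ∀ N, IsREM (P N) N (Y N)) {h : ℝ}
    (hh : 0 ≤ h) {a b : ℝ} (hab : a ≤ b) {ε : ℝ} (hε : 0 < ε) :
    ∃ C : ℝ, ∀ N,
      (P N).real {ω | C < (energyProcess (Y N) h ω).toMeasure.real (Ico a b)} ≤ ε := by
  obtain ⟨K, hK⟩ := (tendsto_sum_measureReal_map_energyPoint hY hh hab).bddAbove_range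
  -- The `+ 1` keeps the threshold positive, so that it can be cancelled at the end.
  refine ⟨(|K| + 1) / ε, fun N => ?_⟩
  obtain ⟨hint, heq⟩ := integral_real_toMeasure_energyProcess (hY N) h
    (measurableSet_Ico (a := a) (b := b))
  have hM := mul_meas_ge_le_integral_of_nonneg (ae_of_all _ fun ω => measureReal_nonneg) hint
    ((|K| + 1) / ε)
  have hle := hK ⟨N, rfl⟩
  simp only at hle
  rw [heq] at hM
  have hmono : (P N).real {ω | (|K| + 1) / ε < (energyProcess (Y N) h ω).toMeasure.real (Ico a b)} ≤
      (P N).real {ω | (|K| + 1) / ε ≤ (energyProcess (Y N) h ω).toMeasure.real (Ico a b)} := by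
    refine measureReal_mono ?_
    intro ω hω
    rw [mem_ofPred_eq] at hω ⊢
    exact hω.le
  refine hmono.trans ?_
  have hpos : 0 < (|K| + 1) / ε := by positivity
  have h1 : (|K| + 1) / ε * (P N).real
      {ω | (|K| + 1) / ε ≤ (energyProcess (Y N) h ω).toMeasure.real (Ico a b)} ≤
      (|K| + 1) / ε * ε := by
    rw [div_mul_cancel₀ _ hε.ne']
    linarith [le_abs_self K]
  exact le_of_mul_le_mul_left h1 hpos

end Limits

/-! ### The limiting Poisson process -/

theorem expIntensity_Ico {a b : ℝ} (hab : a ≤ b) :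
    expIntensity (Ico a b) = ENNReal.ofReal (Real.exp (-a) - Real.exp (-b)) := by
  have hint : ∫ x in a..b, Real.exp (-x) = Real.exp (-a) - Real.exp (-b) := by
    rw [intervalIntegral.integral_eq_sub_of_hasDerivAt (f := fun x => -Real.exp (-x))]
    · ring
    · intro x _
      exact ((hasDerivAt_neg x).exp.neg).congr_deriv (by ring)
    · exact (by fun_prop : Continuous fun x : ℝ => Real.exp (-x)).intervalIntegrable _ _
  rw [expIntensity, withDensity_apply _ measurableSet_Ico, ← hint,
    intervalIntegral.integral_of_le hab, ← integral_Ico_eq_integral_Ioc,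
    ofReal_integral_eq_lintegral_ofReal _ (ae_of_all _ fun x => (Real.exp_pos _).le)]
  exact ((by fun_prop : Continuous fun x : ℝ => Real.exp (-x)).integrableOn_Icc).mono_set
    Ico_subset_Icc_self

namespace IsPoissonPointProcess

variable {Ω : Type*} [MeasurableSpace Ω] {P : Measure Ω} {ν : Measure ℝ} {ξ : Ω → LocFinMeasure}

/-- The pushforward along a map that is not a.e. measurable is `0` by convention, whereas the
prescribed Poisson law is a probability measure. -/
theorem aemeasurable_count (hξ : IsPoissonPointProcess P ν ξ) {B : Set ℝ} (hB : MeasurableSet B)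
    (hν : ν B ≠ ∞) : AEMeasurable (fun ω => (ξ ω).toMeasure B) P := by
  refine AEMeasurable.of_map_ne_zero ?_
  rw [hξ.map_count B hB hν]
  have : IsProbabilityMeasure ((poissonMeasure (ν B).toNNReal).map fun k : ℕ => (k : ℝ≥0∞)) :=
    Measure.isProbabilityMeasure_map Measurable.of_discrete.aemeasurable
  exact IsProbabilityMeasure.ne_zero _

theorem aemeasurable_countReal (hξ : IsPoissonPointProcess P ν ξ) {B : Set ℝ}
    (hB : MeasurableSet B) (hν : ν B ≠ ∞) :
    AEMeasurable (fun ω => (ξ ω).toMeasure.real B) P :=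
  (hξ.aemeasurable_count hB hν).ennreal_toReal

theorem map_countReal (hξ : IsPoissonPointProcess P ν ξ) {B : Set ℝ} (hB : MeasurableSet B)
    (hν : ν B ≠ ∞) : P.map (fun ω => (ξ ω).toMeasure.real B) =
      (poissonMeasure (ν B).toNNReal).map (Nat.cast : ℕ → ℝ) := by
  have h1 : P.map (fun ω => (ξ ω).toMeasure.real B) =
      (P.map fun ω => (ξ ω).toMeasure B).map ENNReal.toReal := by
    rw [AEMeasurable.map_map_of_aemeasurable ENNReal.measurable_toReal.aemeasurable
      (hξ.aemeasurable_count hB hν)]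
    rfl
  rw [h1, hξ.map_count B hB hν, Measure.map_map ENNReal.measurable_toReal Measurable.of_discrete]
  congr 1

theorem charFun_map_counts [IsProbabilityMeasure P] (hξ : IsPoissonPointProcess P ν ξ) {m : ℕ}
    {B : Fin m → Set ℝ} (hB : ∀ j, MeasurableSet (B j))
    (hd : Pairwise fun i j => Disjoint (B i) (B j)) (hν : ∀ j, ν (B j) ≠ ∞)
    (s : EuclideanSpace ℝ (Fin m)) :
    charFun (P.map fun ω => (WithLp.toLp 2 fun j => (ξ ω).toMeasure.real (B j) :
      EuclideanSpace ℝ (Fin m))) s =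
      Complex.exp (∑ j, (ν.real (B j) : ℂ) * (Complex.exp (s j * Complex.I) - 1)) := by
  have hind : iIndepFun (fun j ω => (ξ ω).toMeasure.real (B j)) P :=
    (hξ.indep_counts m B hB hd).comp (fun _ => ENNReal.toReal) fun _ => ENNReal.measurable_toReal
  rw [(iIndepFun_iff_charFun_pi fun j => hξ.aemeasurable_countReal (hB j) (hν j)).1 hind s,
    Complex.exp_sum]
  refine Finset.prod_congr rfl fun j _ => ?_
  rw [hξ.map_countReal (hB j) (hν j), charFun_map_cast_poissonMeasure]
  rfl

end IsPoissonPointProcess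

theorem exists_measureReal_gt_le {Ω : Type*} [MeasurableSpace Ω] {P : Measure Ω}
    [IsFiniteMeasure P] {f : Ω → ℝ} (hf : AEMeasurable f P) {ε : ℝ} (hε : 0 < ε) :
    ∃ C : ℝ, P.real {ω | C < f ω} ≤ ε := by
  obtain ⟨C, hC⟩ := ((tendsto_measureReal_Ici_atTop (P.map f)).eventually_le_const hε).exists
  refine ⟨C, le_trans ?_ hC⟩
  rw [map_measureReal_apply_of_aemeasurable hf measurableSet_Ici]
  refine measureReal_mono ?_
  intro ω hω
  rw [mem_ofPred_eq] at hω
  exact hω.le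

/-! ### Assembly of the limit theorem -/

theorem mainTheorem4 {Ω : ℕ → Type*} [∀ N, MeasurableSpace (Ω N)]
    (P : (N : ℕ) → Measure (Ω N)) [∀ N, IsProbabilityMeasure (P N)]
    (Y : (N : ℕ) → Hypercube N → Ω N → ℝ) (hY : ∀ N, IsREM (P N) N (Y N))
    {Ω' : Type*} [MeasurableSpace Ω'] (P' : Measure Ω') [IsProbabilityMeasure P']
    (ξ : Ω' → LocFinMeasure) (hξ : IsPoissonPointProcess P' expIntensity ξ)
    (h : ℝ) (hh : 0 ≤ h) :
    TendstoInDistribution (fun N => energyProcess (Y N) h) atTop ξ P P' := by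
  have hIco : ∀ {a b : ℝ}, a ≤ b → expIntensity (Ico a b) ≠ ∞ := fun hab => by
    rw [expIntensity_Ico hab]
    exact ENNReal.ofReal_ne_top
  have hneg : ∀ k : ℕ, (-k : ℝ) ≤ k := fun k => by
    have : (0 : ℝ) ≤ k := k.cast_nonneg
    linarith
  refine LocFinMeasure.tendstoInDistribution_of_binMasses
    (fun N => aemeasurable_energyProcess (hY N) h) hξ.measurable.aemeasurable
    (fun k ε hε => exists_measureReal_energyProcess_gt_le hY hh (hneg k) hε)
    (fun k ε hε => exists_measureReal_gt_le
      (hξ.aemeasurable_countReal measurableSet_Ico (hIco (hneg k))) hε) fun n => ?_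
  have hle : ∀ j : Fin (2 * n * n), LocFinMeasure.node n j ≤ LocFinMeasure.node n j + 1 / n :=
    fun j => le_add_of_nonneg_right (by positivity)
  have hbin : ∀ j : Fin (2 * n * n), expIntensity (LocFinMeasure.bin n j) ≠ ∞ := fun j => by
    rw [LocFinMeasure.bin_eq_Ico]
    exact hIco (hle j)
  -- For each grid the limiting rate of a bin is its intensity, and the tail at `(M - h)/2 * √N`
  -- bounds every single-point probability.
  have hmain := tendstoInDistribution_sum_indicator (P := P) (P' := P')
    (Z := fun N => energyPoint (Y N) h) (fun N σ => aemeasurable_energyPoint (hY N) h σ)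
    (fun N => iIndepFun_energyPoint (hY N) h) (B := LocFinMeasure.bin n)
    LocFinMeasure.measurableSet_bin (LocFinMeasure.pairwise_disjoint_bin n)
    (r := fun j => expIntensity.real (LocFinMeasure.bin n j))
    (fun j => by
      rw [LocFinMeasure.bin_eq_Ico, measureReal_def, expIntensity_Ico (hle j),
        ENNReal.toReal_ofReal (sub_nonneg.2 (Real.exp_le_exp.2 (neg_le_neg (hle j))))]
      exact tendsto_sum_measureReal_map_energyPoint hY hh (hle j))
    (tendsto_gaussianTail_mul_sqrt h)
    (fun j => by
      rw [LocFinMeasure.bin_eq_Ico]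
      exact eventually_measureReal_map_energyPoint_le hY hh (hle j))
    (W := fun ω => WithLp.toLp 2 (LocFinMeasure.binMasses n (ξ ω)))
    ((PiLp.continuous_toLp 2 _).measurable.comp_aemeasurable (aemeasurable_pi_lambda _ fun j =>
      hξ.aemeasurable_countReal (LocFinMeasure.measurableSet_bin j) (hbin j)))
    fun s => hξ.charFun_map_counts LocFinMeasure.measurableSet_bin
      (LocFinMeasure.pairwise_disjoint_bin n) hbin s
  convert hmain using 5 with N ω j
  exact real_toMeasure_energyProcess (Y N) h ω (LocFinMeasure.measurableSet_bin j)
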